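/- Let $X$ be a complex Banach space and let $-A$ be the generator of a bounded $C_0$-semigroup $(e^{-tA})_{t\ge 0}$ on $X$. A Stieltjes function is a function of the form $h(z)=a+\int_{[0,\infty)}\frac{\mu(d\tau)}{z+\tau}$ with $a\ge 0$ and $\mu$ a positive Radon measure on $[0,\infty)$ such that $\int_{[0,\infty)}\frac{\mu(d\tau)}{1+\tau}<\infty$; it is identified with its analytic extension to $\mathbb C\setminus(-\infty,0]$. Let $\tilde{\mathcal S}_2$ be the set of all products $f=f_1f_2$ of two Stieltjes functions $f_1,f_2$. For a bounded complex Radon measure $\mu$ on $[0,\infty)$ with Laplace transform $e=\mathcal L\mu$, $e(z)=\int_{[0,\infty)}e^{-sz}\,\mu(ds)$ for $\operatorname{Re}z>0$, put $e(A)x=\int_{[0,\infty)}e^{-sA}x\,\mu(ds)$. A holomorphic function $g$ on $\{\operatorname{Re}z>0\}$ is called regularizable for $A$ if there is such an $e$ for which $e(A)$ is injective and $eg$ is again the Laplace transform of a bounded complex Radon measure on $[0,\infty)$; then $g(A)=e(A)^{-1}(eg)(A)$ with domain $\{x\in X: (eg)(A)x\in\operatorname{ran}e(A)\}$, which does not depend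 on $e$ (the extended Hille-Phillips calculus). For $\delta>0$, $-(A+\delta)$ generates the bounded $C_0$-semigroup $(e^{-\delta t}e^{-tA})_{t\ge 0}$, and $g(A+\delta)$ is understood in the same way with respect to it. Theorem. Let $f\in\tilde{\mathcal S}_2$, $f\ne 0$, and $g=1/f$. Then $g$ is regularizable for $A$ and for $A+\delta$ for every $\delta>0$; the domains of $g(A)$ and of all $g(A+\delta)$, $\delta>0$, contain $\operatorname{dom}(A^2)$; and for every $x\in\operatorname{dom}(A^2)$, $$\lim_{\delta\to 0+}g(A+\delta)x=g(A)x .$$ -/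

import Mathlib

open Filter Topology MeasureTheory
open scoped NNReal

noncomputable section

/-! ## Bounded complex Radon measures on `[0, ∞)` and their Laplace transforms

Complex measures on the Polish space `[0, ∞)` are automatically bounded and Radon. -/

/-- A complex measure has finite total variation. -/
theorem MeasureTheory.ComplexMeasure.variation_univ_lt_top {α : Type*} [MeasurableSpace α]
    (μ : ComplexMeasure α) : μ.variation Set.univ < ⊤ := by
  have h : μ.variation ≤
      (ComplexMeasure.re μ).totalVariation + (ComplexMeasure.im μ).totalVariation := by
    refine VectorMeasure.variation_le_of_forall_enorm_le fun E _ => ?_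
    have h1 := SignedMeasure.enorm_le_totalVariation (ComplexMeasure.re μ) E
    have h2 := SignedMeasure.enorm_le_totalVariation (ComplexMeasure.im μ) E
    have h3 : ‖μ E‖ₑ ≤ ‖(ComplexMeasure.re μ) E‖ₑ + ‖(ComplexMeasure.im μ) E‖ₑ := by
      have h4 : ‖μ E‖₊ ≤ ‖(μ E).re‖₊ + ‖(μ E).im‖₊ := by
        have := Complex.norm_le_abs_re_add_abs_im (μ E)
        exact_mod_cast this
      simp only [ComplexMeasure.re_apply, ComplexMeasure.im_apply, enorm]
      exact_mod_cast h4
    exact h3.trans (add_le_add h1 h2)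
  refine lt_of_le_of_lt (h Set.univ) ?_
  simp only [Measure.coe_add, Pi.add_apply, SignedMeasure.totalVariation]
  simp [ENNReal.add_lt_top, measure_lt_top]

/-- The integral `∫ F dμ` of a function with values in a complex Banach space against a complex
measure `μ`, that is, the vector-measure integral for the pairing `(v, c) ↦ c • v`. -/
def cmIntegral {α E : Type*} [MeasurableSpace α] [NormedAddCommGroup E] [NormedSpace ℂ E]
    (μ : ComplexMeasure α) (F : α → E) : E :=
  μ.integral F (ContinuousLinearMap.lsmul ℝ ℂ : ℂ →L[ℝ] E →L[ℝ] E).flip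

theorem cmIntegral_add {α E : Type*} [MeasurableSpace α] [NormedAddCommGroup E] [NormedSpace ℂ E]
    (μ : ComplexMeasure α) {F G : α → E} (hF : μ.Integrable F) (hG : μ.Integrable G) :
    cmIntegral μ (fun s => F s + G s) = cmIntegral μ F + cmIntegral μ G :=
  VectorMeasure.integral_fun_add hF hG

theorem cmIntegral_smul {α E : Type*} [MeasurableSpace α] [NormedAddCommGroup E] [NormedSpace ℂ E]
    (μ : ComplexMeasure α) (c : ℂ) (F : α → E) :
    cmIntegral μ (fun s => c • F s) = c • cmIntegral μ F := by
  unfold cmIntegral VectorMeasure.integral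
  refine setToFun_smul _ (fun c' s v => ?_) c F
  exact smul_comm (μ s) c' v

/-- The Laplace transform `(ℒμ)(z) = ∫₀^∞ e^{-sz} μ(ds)`. -/
def laplace (μ : ComplexMeasure ℝ≥0) (z : ℂ) : ℂ :=
  cmIntegral μ fun s : ℝ≥0 => Complex.exp (-((s : ℝ) : ℂ) * z)

/-! ## Bounded `C₀`-semigroups and their generators -/

/-- A bounded `C₀`-semigroup `(T t)_{t ≥ 0}` on a complex normed space. -/
structure BoundedC0Semigroup (X : Type*) [NormedAddCommGroup X] [NormedSpace ℂ X] where
  /-- the operator `T t` -/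
  toFun : ℝ≥0 → X →L[ℂ] X
  map_zero : toFun 0 = ContinuousLinearMap.id ℂ X
  map_add : ∀ s t, toFun (s + t) = (toFun s).comp (toFun t)
  continuous_orbit : ∀ x, Continuous fun t => toFun t x
  bounded : ∃ M : ℝ, ∀ t, ‖toFun t‖ ≤ M

section

variable {X : Type*} [NormedAddCommGroup X] [NormedSpace ℂ X]

/-- `B` is the (infinitesimal) generator of `T`: `x ∈ dom B` and `B x = y` if and only if
`(T h x - x) / h → y` as `h → 0+`. -/
def IsGenerator (T : BoundedC0Semigroup X) (B : X →ₗ.[ℂ] X) : Prop :=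
  ∀ x y : X, (x, y) ∈ B.graph ↔
    Tendsto (fun h : ℝ≥0 => ((h : ℝ)⁻¹ : ℝ) • (T.toFun h x - x)) (𝓝[>] 0) (𝓝 y)

/-- The domain of `A²`: all `x ∈ dom A` with `A x ∈ dom A`. -/
def domSq (A : X →ₗ.[ℂ] X) : Set X :=
  {x | ∃ h : x ∈ A.domain, A ⟨x, h⟩ ∈ A.domain}

/-- The operator `A + δ`, with domain `dom A`. -/
def addScalar (A : X →ₗ.[ℂ] X) (δ : ℝ≥0) : X →ₗ.[ℂ] X :=
  (((δ : ℝ) : ℂ) • (LinearMap.id : X →ₗ[ℂ] X)) +ᵥ A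

/-- The rescaled semigroup `(e^{-δt} T t)_{t ≥ 0}`. If `-A` generates `T`, this is the semigroup
generated by `-(A + δ)`, see `IsGenerator.shift`. -/
def BoundedC0Semigroup.shift (T : BoundedC0Semigroup X) (δ : ℝ≥0) : BoundedC0Semigroup X where
  toFun t := ((Real.exp (-((δ : ℝ) * (t : ℝ))) : ℝ) : ℂ) • T.toFun t
  map_zero := by simp [T.map_zero]
  map_add s t := by
    rw [T.map_add]
    ext x
    simp only [smul_apply, ContinuousLinearMap.comp_apply, map_smul, smul_smul]
    rw [← Complex.ofReal_mul, ← Real.exp_add]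
    congr 3
    push_cast
    ring_nf
  continuous_orbit x := by
    have := T.continuous_orbit x
    simp only [smul_apply]
    fun_prop
  bounded := by
    obtain ⟨M, hM⟩ := T.bounded
    refine ⟨M, fun t => ?_⟩
    rw [norm_smul, Complex.norm_real, Real.norm_eq_abs, abs_of_pos (Real.exp_pos _)]
    refine le_trans (mul_le_of_le_one_left (norm_nonneg _) ?_) (hM t)
    exact Real.exp_le_one_iff.2 (neg_nonpos.2 (by positivity))

/-- If `-A` generates `(T t)`, then `-(A + δ)` generates `(e^{-δt} T t)`. -/
theorem IsGenerator.shift {T : BoundedC0Semigroup X} {A : X →ₗ.[ℂ] X} (hA : IsGenerator T (-A))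
    (δ : ℝ≥0) : IsGenerator (T.shift δ) (-(addScalar A δ)) := by
  intro x y
  have hgraph : (x, y) ∈ (-(addScalar A δ)).graph ↔ (x, y + (δ : ℝ) • x) ∈ (-A).graph := by
    simp only [LinearPMap.mem_graph_iff]
    constructor
    · rintro ⟨⟨u, hu⟩, h1, h2⟩
      obtain rfl : u = x := h1
      refine ⟨⟨u, hu⟩, rfl, ?_⟩
      have h3 : -(((δ : ℝ) : ℂ) • u + A ⟨u, hu⟩) = y := h2
      rw [← h3]
      change -(A ⟨u, hu⟩) = _
      rw [Complex.coe_smul]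
      abel
    · rintro ⟨⟨u, hu⟩, h1, h2⟩
      obtain rfl : u = x := h1
      refine ⟨⟨u, hu⟩, rfl, ?_⟩
      have h3 : -(A ⟨u, hu⟩) = y + (δ : ℝ) • u := h2
      change -(((δ : ℝ) : ℂ) • u + A ⟨u, hu⟩) = y
      rw [neg_add, h3, Complex.coe_smul]
      abel
  rw [hgraph, hA x]
  have hcoe : Tendsto (fun h : ℝ≥0 => (h : ℝ)) (𝓝[>] 0) (𝓝[≠] 0) := by
    refine tendsto_nhdsWithin_iff.2 ⟨?_, ?_⟩
    · exact (NNReal.continuous_coe.tendsto' 0 0 rfl).mono_left nhdsWithin_le_nhds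
    · filter_upwards [self_mem_nhdsWithin] with h hh
      have : (0 : ℝ≥0) < h := hh
      simpa using this.ne'
  have hexp : Tendsto (fun h : ℝ≥0 => Real.exp (-((δ : ℝ) * (h : ℝ)))) (𝓝[>] 0) (𝓝 1) := by
    have hc : Continuous fun h : ℝ≥0 => Real.exp (-((δ : ℝ) * (h : ℝ))) := by fun_prop
    exact (hc.tendsto' 0 1 (by simp)).mono_left nhdsWithin_le_nhds
  have hexp' : Tendsto (fun h : ℝ≥0 => Real.exp ((δ : ℝ) * (h : ℝ))) (𝓝[>] 0) (𝓝 1) := by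
    have hc : Continuous fun h : ℝ≥0 => Real.exp ((δ : ℝ) * (h : ℝ)) := by fun_prop
    exact (hc.tendsto' 0 1 (by simp)).mono_left nhdsWithin_le_nhds
  have hder : Tendsto (fun h : ℝ≥0 => (h : ℝ)⁻¹ * (Real.exp (-((δ : ℝ) * (h : ℝ))) - 1))
      (𝓝[>] 0) (𝓝 (-(δ : ℝ))) := by
    have hd : HasDerivAt (fun u : ℝ => Real.exp (-((δ : ℝ) * u))) (-(δ : ℝ)) 0 := by
      have h1 : HasDerivAt (fun u : ℝ => -((δ : ℝ) * u)) (-((δ : ℝ) * 1)) 0 :=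
        ((hasDerivAt_id 0).const_mul _).neg
      simpa using h1.exp
    have := (hasDerivAt_iff_tendsto_slope.1 hd).comp hcoe
    refine this.congr fun h => ?_
    simp [slope_def_field, div_eq_inv_mul]
  have hderx : Tendsto (fun h : ℝ≥0 =>
      ((h : ℝ)⁻¹ * (Real.exp (-((δ : ℝ) * (h : ℝ))) - 1)) • x) (𝓝[>] 0) (𝓝 (-((δ : ℝ) • x))) := by
    simpa [neg_smul] using hder.smul_const x
  have hid : ∀ h : ℝ≥0, ((h : ℝ)⁻¹ : ℝ) • ((T.shift δ).toFun h x - x) =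
      Real.exp (-((δ : ℝ) * (h : ℝ))) • (((h : ℝ)⁻¹ : ℝ) • (T.toFun h x - x)) +
        ((h : ℝ)⁻¹ * (Real.exp (-((δ : ℝ) * (h : ℝ))) - 1)) • x := by
    intro h
    change ((h : ℝ)⁻¹ : ℝ) •
      (((Real.exp (-((δ : ℝ) * (h : ℝ))) : ℝ) : ℂ) • T.toFun h x - x) = _
    rw [Complex.coe_smul]
    module
  constructor
  · intro H
    have := (hexp.smul H).add hderx
    rw [one_smul, add_neg_cancel_right] at this
    exact this.congr fun h => (hid h).symm
  · intro H
    have h1 := hexp'.smul (H.sub hderx)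
    rw [one_smul, sub_neg_eq_add] at h1
    refine h1.congr fun h => ?_
    rw [hid h, add_sub_cancel_right, smul_smul, ← Real.exp_add]
    simp

/-! ## The Hille-Phillips calculus and its extension -/

theorem BoundedC0Semigroup.integrable_orbit (T : BoundedC0Semigroup X)
    (μ : ComplexMeasure ℝ≥0) (x : X) : μ.Integrable fun s => T.toFun s x := by
  obtain ⟨M, hM⟩ := T.bounded
  have : IsFiniteMeasure μ.variation := ⟨μ.variation_univ_lt_top⟩
  refine Integrable.of_bound (C := M * ‖x‖) (T.continuous_orbit x).aestronglyMeasurable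
    (Eventually.of_forall fun s => ?_)
  exact (T.toFun s).le_of_opNorm_le (hM s) x

/-- The Hille-Phillips calculus: if `-A` generates `T` and `g = ℒμ`, then `g(A)` is the operator
`x ↦ ∫₀^∞ T s x μ(ds)`. -/
def hillePhillips (T : BoundedC0Semigroup X) (μ : ComplexMeasure ℝ≥0) : X →ₗ[ℂ] X where
  toFun x := cmIntegral μ fun s => T.toFun s x
  map_add' x y := by
    simp only [_root_.map_add]
    exact cmIntegral_add μ (T.integrable_orbit μ x) (T.integrable_orbit μ y)
  map_smul' c x := by
    simp only [map_smul, RingHom.id_apply]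
    exact cmIntegral_smul μ c _

/-- A regularizer for `f` with respect to the operator `A`, where `-A` generates `T`: a function
`e = ℒμ` such that `e f = ℒν` on `{Re z > 0}` for a complex measure `ν` on `[0, ∞)` and such
that `e(A)` is injective. -/
structure Regularizer (T : BoundedC0Semigroup X) (f : ℂ → ℂ) where
  /-- the measure with `e = ℒμ` -/
  μ : ComplexMeasure ℝ≥0
  /-- the measure with `e f = ℒν` -/
  ν : ComplexMeasure ℝ≥0
  laplace_eq : ∀ z : ℂ, 0 < z.re → laplace ν z = laplace μ z * f z
  injective : Function.Injective (hillePhillips T μ)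

/-- The operator `e(A)⁻¹ (ef)(A)`, with domain `{x | (ef)(A) x ∈ ran e(A)}`. -/
def Regularizer.op {T : BoundedC0Semigroup X} {f : ℂ → ℂ} (R : Regularizer T f) :
    X →ₗ.[ℂ] X where
  domain := (LinearMap.range (hillePhillips T R.μ)).comap (hillePhillips T R.ν)
  toFun :=
    (LinearEquiv.ofInjective (hillePhillips T R.μ) R.injective).symm.toLinearMap ∘ₗ
      ((hillePhillips T R.ν).restrict fun _ h => h)

/-- `f` is holomorphic on `{Re z > 0}` and has a regularizer, where `-A` generates `T`. -/
def IsRegularizable (T : BoundedC0Semigroup X) (f : ℂ → ℂ) : Prop :=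
  DifferentiableOn ℂ f {z | 0 < z.re} ∧ Nonempty (Regularizer T f)

/-- The operator `f(A)` of the extended Hille-Phillips calculus, where `-A` generates `T`, for a
regularizable `f`. It is computed with some regularizer, the choice of which is immaterial. -/
def extHP (T : BoundedC0Semigroup X) (f : ℂ → ℂ) (hf : IsRegularizable T f) : X →ₗ.[ℂ] X :=
  (Classical.choice hf.2).op

end

/-! ## Stieltjes functions -/

/-- `f` is (the analytic extension to `ℂ \ (-∞, 0]` of) a Stieltjes function:
`f z = a + ∫ μ(dτ) / (z + τ)` with `a ≥ 0` and a positive measure `μ` on `[0, ∞)` such that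
`∫ μ(dτ) / (1 + τ) < ∞` (in particular, `μ` is locally finite, hence Radon). -/
def IsStieltjes (f : ℂ → ℂ) : Prop :=
  ∃ (a : ℝ≥0) (μ : Measure ℝ≥0), Integrable (fun τ : ℝ≥0 => (1 + (τ : ℝ))⁻¹) μ ∧
    ∀ z ∈ Complex.slitPlane,
      f z = ((a : ℝ) : ℂ) + ∫ τ : ℝ≥0, (z + ((τ : ℝ) : ℂ))⁻¹ ∂μ

/-- The class of products of two Stieltjes functions. -/
def IsStieltjesProduct (f : ℂ → ℂ) : Prop :=
  ∃ f₁ f₂ : ℂ → ℂ, IsStieltjes f₁ ∧ IsStieltjes f₂ ∧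
    ∀ z ∈ Complex.slitPlane, f z = f₁ z * f₂ z

end

/-! ### Complex measures as densities -/

section Density

variable {α Ω E : Type*} [MeasurableSpace α] [MeasurableSpace Ω]
  [NormedAddCommGroup E] [NormedSpace ℂ E]

/-! The reciprocal of a nonzero Stieltjes function, divided by `1 + z`, is the Laplace transform of
a bounded measure (`IsStieltjes.exists_laplaceTransform_reciprocal`). Hence for `g = 1 / (f₁ f₂)`
the function `(1 + z)⁻² g` is one too, and `e(z) = (1 + z)⁻²` regularizes `g` for every bounded
semigroup at once, because `e(A) = (1 + A)⁻²` is injective. For `x ∈ dom(A²)` put `y_δ = (1 + δ +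
A)² x`. Then `x = e(A + δ) y_δ`, so `g(A + δ) x = (eg)(A + δ) y_δ`. Here `y_δ → y_0`, and the
measure of `eg` does not depend on `δ`, so dominated convergence gives the limit
(`tendsto_extHP_shift`).

The fact on reciprocals is proved with operators. With `t = 1 / (1 + τ)` and `w = z - 1`, a
Stieltjes function becomes `∫ (1 + wt)⁻¹ ρ(dt)` with `ρ` finite on `[0, 1]`, that is, `⟨u, (1 +
wΘ)⁻¹ u⟩` for multiplication `Θ` by `t` on `L²(ρ)` and `u = 1`. A Schur complement expresses its
reciprocal through the resolvent of the compression of `Θ` to the complement of `u`, hence through a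
spectral measure `σ` on `[0, 1]` (`exists_schur_complement`, `exists_reciprocal_transform`).
Positivity of the reciprocal on `w > -1` makes `1/t` and `1/(1 - t)` integrable for `σ`, which turns
the formula into a mixture of exponential distributions (`exists_laplaceTransform_reciprocal`).

Independence of the regularizer rests on uniqueness of the Laplace transform
(`hillePhillips_comp_congr`). -/

instance ComplexMeasure.isFiniteMeasure_variation (c : ComplexMeasure α) :
    IsFiniteMeasure c.variation := ⟨c.variation_univ_lt_top⟩

theorem cmIntegral_indicator_const [CompleteSpace E] (c : ComplexMeasure α) {s : Set α}
    (hs : MeasurableSet s) (x : E) : cmIntegral c (s.indicator fun _ => x) = c s • x := by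
  unfold cmIntegral
  rw [VectorMeasure.integral_eq_setToFun, setToFun_indicator_const _ hs (measure_ne_top _ _)]
  rfl

/-- If `c` is the image under `φ` of the complex measure with density `h` relative to `m`, then
`∫ F dc = ∫ h • (F ∘ φ) dm`. -/
theorem cmIntegral_eq_integral_density [CompleteSpace E] (c : ComplexMeasure α) (m : Measure Ω)
    {h : Ω → ℂ} (hh : Integrable h m) {φ : Ω → α} (hφ : Measurable φ)
    (hc : ∀ s, MeasurableSet s → c s = ∫ ω in φ ⁻¹' s, h ω ∂m)
    {F : α → E} (hF : StronglyMeasurable F) {C : ℝ} (hC : ∀ s, ‖F s‖ ≤ C) :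
    cmIntegral c F = ∫ ω, h ω • F (φ ω) ∂m := by
  -- For simple functions both sides are linear and agree on indicators; bounded simple
  -- approximations of `F` then allow dominated convergence on both sides.
  have hsimple : ∀ G : SimpleFunc α E, cmIntegral c G = ∫ ω, h ω • G (φ ω) ∂m := by
    intro G
    have hint : ∀ G : SimpleFunc α E, Integrable (fun ω => h ω • G (φ ω)) m := by
      intro G
      obtain ⟨B, hB⟩ := G.exists_forall_norm_le
      exact hh.smul_bdd B ((G.stronglyMeasurable.comp_measurable hφ).aestronglyMeasurable)
        (Eventually.of_forall fun ω => hB _)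
    have hint' : ∀ G : SimpleFunc α E, c.Integrable G := by
      intro G
      obtain ⟨B, hB⟩ := G.exists_forall_norm_le
      exact Integrable.of_bound (C := B) G.stronglyMeasurable.aestronglyMeasurable
        (Eventually.of_forall hB)
    induction G using SimpleFunc.induction with
    | const x hs =>
      rename_i s
      have h1 : (⇑(SimpleFunc.piecewise s hs (SimpleFunc.const α x) (SimpleFunc.const α 0)))
          = s.indicator fun _ => x := by
        ext a; simp [Set.indicator, Set.piecewise]
      rw [h1, cmIntegral_indicator_const c hs, hc s hs, ← integral_smul_const,
        ← integral_indicator (hφ hs)]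
      refine integral_congr_ae (Eventually.of_forall fun ω => ?_)
      by_cases hω : φ ω ∈ s <;> simp [Set.indicator, hω]
    | add hfg hf hg =>
      rename_i f g
      have := cmIntegral_add c (hint' f) (hint' g)
      simp only [SimpleFunc.coe_add, Pi.add_apply, smul_add]
      rw [integral_add (hint f) (hint g), ← hf, ← hg, ← this]
      rfl
  -- `α` may be empty, so the sign of `C` is only available at a point.
  have hC0 : ∀ s, 0 ≤ C := fun s => (norm_nonneg _).trans (hC s)
  have h1 : Tendsto (fun n => cmIntegral c (hF.approxBounded C n)) atTop (𝓝 (cmIntegral c F)) := by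
    unfold cmIntegral
    simp only [VectorMeasure.integral_eq_setToFun]
    refine tendsto_setToFun_of_dominated_convergence _ (fun _ => C)
      (fun n => (hF.approxBounded C n).stronglyMeasurable.aestronglyMeasurable)
      (integrable_const C) (fun n => Eventually.of_forall fun s => ?_)
      (Eventually.of_forall fun s => hF.tendsto_approxBounded_of_norm_le (hC s))
    exact hF.norm_approxBounded_le (hC0 s) n s
  have h2 : Tendsto (fun n => ∫ ω, h ω • hF.approxBounded C n (φ ω) ∂m) atTop
      (𝓝 (∫ ω, h ω • F (φ ω) ∂m)) := by
    refine tendsto_integral_of_dominated_convergence (fun ω => ‖h ω‖ * C) (fun n => ?_)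
      (hh.norm.mul_const C) (fun n => Eventually.of_forall fun ω => ?_)
      (Eventually.of_forall fun ω => ?_)
    · exact hh.aestronglyMeasurable.smul
        (((hF.approxBounded C n).stronglyMeasurable.comp_measurable hφ).aestronglyMeasurable)
    · rw [norm_smul]
      exact mul_le_mul_of_nonneg_left (hF.norm_approxBounded_le (hC0 (φ ω)) n _) (norm_nonneg _)
    · exact (hF.tendsto_approxBounded_of_norm_le (hC (φ ω))).const_smul _
  refine tendsto_nhds_unique h1 (h2.congr fun n => (hsimple _).symm)

/-- The complex measure with density `h` relative to `m`, transported by `φ`. -/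
theorem exists_complexMeasure_density (m : Measure Ω)
    {h : Ω → ℂ} (hh : Integrable h m) {φ : Ω → α} (hφ : Measurable φ) :
    ∃ c : ComplexMeasure α, ∀ s, MeasurableSet s → c s = ∫ ω in φ ⁻¹' s, h ω ∂m := by
  refine ⟨(m.withDensityᵥ h).map φ, fun s hs => ?_⟩
  rw [VectorMeasure.map_apply _ hφ hs, withDensityᵥ_apply hh (hφ hs)]

/-- Every complex measure has a density relative to each finite measure dominating its
variation. -/
theorem exists_density_of_variation_le (c : ComplexMeasure α) (m : Measure α) [IsFiniteMeasure m]
    (hm : c.variation ≤ m) :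
    ∃ h : α → ℂ, Integrable h m ∧ ∀ s, MeasurableSet s → c s = ∫ ω in s, h ω ∂m := by
  -- This gives absolute continuity of the real and imaginary parts, to which Radon-Nikodym applies
  -- separately.
  have key : ∀ s, m s = 0 → c s = 0 := by
    intro s hs
    have h1 : c.variation s = 0 := le_antisymm ((hm s).trans hs.le) bot_le
    have := c.enorm_measure_le_variation s
    rw [h1] at this
    simpa using this
  have hcre : ∀ s, ComplexMeasure.re c s = (c s).re := fun s => rfl
  have hcim : ∀ s, ComplexMeasure.im c s = (c s).im := fun s => rfl
  have hre : ComplexMeasure.re c ≪ᵥ m.toENNRealVectorMeasure := by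
    refine VectorMeasure.AbsolutelyContinuous.mk fun s hs h0 => ?_
    rw [Measure.toENNRealVectorMeasure_apply_measurable hs] at h0
    rw [hcre, key s h0, Complex.zero_re]
  have him : ComplexMeasure.im c ≪ᵥ m.toENNRealVectorMeasure := by
    refine VectorMeasure.AbsolutelyContinuous.mk fun s hs h0 => ?_
    rw [Measure.toENNRealVectorMeasure_apply_measurable hs] at h0
    rw [hcim, key s h0, Complex.zero_im]
  have e1 := SignedMeasure.withDensityᵥ_rnDeriv_eq _ m hre
  have e2 := SignedMeasure.withDensityᵥ_rnDeriv_eq _ m him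
  have i1 := SignedMeasure.integrable_rnDeriv (ComplexMeasure.re c) m
  have i2 := SignedMeasure.integrable_rnDeriv (ComplexMeasure.im c) m
  refine ⟨fun a => ((ComplexMeasure.re c).rnDeriv m a : ℂ) +
    ((ComplexMeasure.im c).rnDeriv m a : ℂ) * Complex.I,
    i1.ofReal.add (i2.ofReal.mul_const _), fun s hs => ?_⟩
  have j1 : IntegrableOn (fun a => (((ComplexMeasure.re c).rnDeriv m a : ℝ) : ℂ)) s m :=
    i1.ofReal.integrableOn
  have j2 : IntegrableOn (fun a => (((ComplexMeasure.im c).rnDeriv m a : ℝ) : ℂ) * Complex.I) s m :=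
    (i2.ofReal.mul_const _).integrableOn
  rw [integral_add j1 j2, integral_mul_const, integral_complex_ofReal, integral_complex_ofReal,
    ← withDensityᵥ_apply i1 hs, ← withDensityᵥ_apply i2 hs, e1, e2, hcre, hcim, Complex.re_add_im]

end Density

/-! ### Uniqueness of the Laplace transform -/

section Uniqueness

variable {Ω E : Type*} [MeasurableSpace Ω] [NormedAddCommGroup E] [NormedSpace ℂ E]

/-- The function `s ↦ e^{-sz}` is bounded by `1` for `Re z ≥ 0`. -/
theorem norm_cexp_neg_mul_le (s : ℝ≥0) {z : ℂ} (hz : 0 ≤ z.re) :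
    ‖Complex.exp (-((s : ℝ) : ℂ) * z)‖ ≤ 1 := by
  rw [Complex.norm_exp, Real.exp_le_one_iff]
  simp only [Complex.mul_re, Complex.neg_re, Complex.ofReal_re, Complex.neg_im, Complex.ofReal_im]
  nlinarith [s.2, mul_nonneg s.2 hz, NNReal.coe_nonneg s, mul_nonneg (NNReal.coe_nonneg s) hz]

theorem integral_map_withDensity_ofReal (m : Measure Ω) {h : Ω → ℝ} (hh : Integrable h m)
    {ψ : Ω → ℝ} (hψ : Measurable ψ) {G : ℝ → E} (hG : StronglyMeasurable G) :
    ∫ t, G t ∂((m.withDensity fun ω => ENNReal.ofReal (h ω)).map ψ) =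
      ∫ ω, (max (h ω) 0) • G (ψ ω) ∂m := by
  rw [integral_map hψ.aemeasurable hG.aestronglyMeasurable]
  have := integral_withDensity_eq_integral_toReal_smul₀ (μ := m)
    (f := fun ω => ENNReal.ofReal (h ω)) hh.aestronglyMeasurable.aemeasurable.ennreal_ofReal
    (Eventually.of_forall fun ω => ENNReal.ofReal_lt_top) (fun ω => G (ψ ω))
  rw [this]
  simp [ENNReal.toReal_ofReal']

/-- Splitting `h` into positive and negative parts reduces uniqueness to finite positive measures,
which are determined by their characteristic functions. -/
theorem integral_density_eq_sub (m : Measure Ω) {h : Ω → ℝ} (hh : Integrable h m)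
    {ψ : Ω → ℝ} (hψ : Measurable ψ) {G : ℝ → E} (hG : StronglyMeasurable G) {C : ℝ}
    (hC : ∀ ω, ‖G (ψ ω)‖ ≤ C) :
    ∫ ω, (h ω : ℂ) • G (ψ ω) ∂m =
      ∫ t, G t ∂((m.withDensity fun ω => ENNReal.ofReal (h ω)).map ψ) -
        ∫ t, G t ∂((m.withDensity fun ω => ENNReal.ofReal (-h ω)).map ψ) := by
  have e2 := integral_map_withDensity_ofReal m hh.neg hψ hG
  simp only [Pi.neg_apply] at e2
  rw [integral_map_withDensity_ofReal m hh hψ hG, e2]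
  have hi : ∀ h : Ω → ℝ, Integrable h m → Integrable (fun ω => (max (h ω) 0) • G (ψ ω)) m :=
    fun h hh => hh.pos_part.smul_bdd C (hG.comp_measurable hψ).aestronglyMeasurable
      (Eventually.of_forall fun ω => hC _)
  rw [← integral_sub (hi h hh) (hi (fun ω => -h ω) hh.neg)]
  refine integral_congr_ae (Eventually.of_forall fun ω => ?_)
  simp only
  rw [← sub_smul, Complex.coe_smul]
  congr 1
  rcases le_total (h ω) 0 with h0 | h0
  · rw [max_eq_right h0, max_eq_left (by linarith)]; ring
  · rw [max_eq_left h0, max_eq_right (by linarith)]; ring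

/-- Uniqueness of the Laplace transform for real densities. -/
theorem integral_smul_eq_zero_of_charFun_real (m : Measure Ω) {h : Ω → ℝ}
    (hh : Integrable h m) {φ : Ω → ℝ≥0} (hφ : Measurable φ)
    (H : ∀ ξ : ℝ, ∫ ω, (h ω : ℂ) * Complex.exp ((φ ω : ℝ) * ξ * Complex.I) ∂m = 0)
    {F : ℝ≥0 → E} (hF : StronglyMeasurable F) {C : ℝ} (hC : ∀ s, ‖F s‖ ≤ C) :
    ∫ ω, (h ω : ℂ) • F (φ ω) ∂m = 0 := by
  have hψ : Measurable fun ω => (φ ω : ℝ) := hφ.coe_nnreal_real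
  set p := (m.withDensity fun ω => ENNReal.ofReal (h ω)).map fun ω => (φ ω : ℝ) with hp
  set q := (m.withDensity fun ω => ENNReal.ofReal (-h ω)).map fun ω => (φ ω : ℝ) with hq
  have hfp : IsFiniteMeasure (m.withDensity fun ω => ENNReal.ofReal (h ω)) :=
    isFiniteMeasure_withDensity_ofReal hh.2
  have hfq : IsFiniteMeasure (m.withDensity fun ω => ENNReal.ofReal (-h ω)) :=
    isFiniteMeasure_withDensity_ofReal hh.neg.2
  have hpq : p = q := by
    refine Measure.ext_of_charFun ?_
    ext ξ
    simp only [charFun_apply_real]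
    have := integral_density_eq_sub m hh hψ (G := fun t : ℝ => Complex.exp (ξ * t * Complex.I))
      (C := 1) (by fun_prop) (fun t => by
        rw [← Complex.ofReal_mul, Complex.norm_exp_ofReal_mul_I])
    rw [← sub_eq_zero, ← this, ← H ξ]
    refine integral_congr_ae (Eventually.of_forall fun ω => ?_)
    simp only [smul_eq_mul]
    congr 2
    ring
  have := integral_density_eq_sub m hh hψ (G := fun t : ℝ => F t.toNNReal)
    (hF.comp_measurable measurable_real_toNNReal) (C := C) (fun t => hC _)
  simpa [← hp, ← hq, hpq] using this

/-- Uniqueness of the Laplace transform: if the image under `φ` of `h dm` has zero Laplace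
transform, then it integrates every bounded measurable function to zero. -/
theorem integral_smul_eq_zero_of_laplace (m : Measure Ω) {h : Ω → ℂ}
    (hh : Integrable h m) {φ : Ω → ℝ≥0} (hφ : Measurable φ)
    (H : ∀ z : ℂ, 0 < z.re → ∫ ω, h ω * Complex.exp (-((φ ω : ℝ) : ℂ) * z) ∂m = 0)
    {F : ℝ≥0 → E} (hF : StronglyMeasurable F) {C : ℝ} (hC : ∀ s, ‖F s‖ ≤ C) :
    ∫ ω, h ω • F (φ ω) ∂m = 0 := by
  have hm : ∀ z : ℂ, AEStronglyMeasurable (fun ω => Complex.exp (-((φ ω : ℝ) : ℂ) * z)) m := by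
    intro z
    have : Measurable fun ω => Complex.exp (-((φ ω : ℝ) : ℂ) * z) := by fun_prop
    exact this.aestronglyMeasurable
  -- Vanishing passes from the open half-plane to the imaginary axis: take `z = ε - iξ` and let `ε →
  -- 0+`, with majorant `‖h‖`.
  have hbd : ∀ ξ : ℝ, ∫ ω, h ω * Complex.exp ((φ ω : ℝ) * ξ * Complex.I) ∂m = 0 := by
    intro ξ
    have ht : Tendsto (fun ε : ℝ => ∫ ω, h ω * Complex.exp (-((φ ω : ℝ) : ℂ) *
        (ε - ξ * Complex.I)) ∂m) (𝓝[>] 0)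
        (𝓝 (∫ ω, h ω * Complex.exp (-((φ ω : ℝ) : ℂ) * ((0 : ℝ) - ξ * Complex.I)) ∂m)) := by
      refine tendsto_integral_filter_of_dominated_convergence (fun ω => ‖h ω‖)
        (Eventually.of_forall fun ε => hh.aestronglyMeasurable.mul (hm _)) ?_ hh.norm
        (Eventually.of_forall fun ω => ?_)
      · filter_upwards [self_mem_nhdsWithin] with ε hε
        have hε : (0 : ℝ) < ε := hε
        refine Eventually.of_forall fun ω => ?_
        rw [norm_mul]
        exact mul_le_of_le_one_right (norm_nonneg _) (norm_cexp_neg_mul_le _ (by simpa using hε.le))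
      · have : Continuous fun ε : ℝ => h ω * Complex.exp (-((φ ω : ℝ) : ℂ) *
          (ε - ξ * Complex.I)) := by fun_prop
        exact this.continuousAt.tendsto.mono_left nhdsWithin_le_nhds
    have h0 : Tendsto (fun ε : ℝ => ∫ ω, h ω * Complex.exp (-((φ ω : ℝ) : ℂ) *
        (ε - ξ * Complex.I)) ∂m) (𝓝[>] 0) (𝓝 0) := by
      refine tendsto_const_nhds.congr' ?_
      filter_upwards [self_mem_nhdsWithin] with ε hε
      have hε : (0 : ℝ) < ε := hε
      exact (H _ (by simpa using hε)).symm
    rw [← tendsto_nhds_unique ht h0]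
    refine integral_congr_ae (Eventually.of_forall fun ω => ?_)
    simp only
    congr 2
    push_cast
    ring
  have hexpi : ∀ ξ : ℝ, Integrable (fun ω => h ω * Complex.exp ((φ ω : ℝ) * ξ * Complex.I)) m := by
    intro ξ
    have : Measurable fun ω => Complex.exp ((φ ω : ℝ) * ξ * Complex.I) := by fun_prop
    refine hh.mul_bdd (c := 1) this.aestronglyMeasurable (Eventually.of_forall fun ω => ?_)
    rw [← Complex.ofReal_mul, Complex.norm_exp_ofReal_mul_I]
  -- Conjugating the identity at `-ξ` gives the same identity for the conjugate of `h`, hence for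
  -- its real and imaginary parts.
  have hconj : ∀ ξ : ℝ, ∫ ω, (starRingEnd ℂ) (h ω) * Complex.exp ((φ ω : ℝ) * ξ * Complex.I) ∂m
      = 0 := by
    intro ξ
    have := congrArg (starRingEnd ℂ) (hbd (-ξ))
    rw [← integral_conj, map_zero] at this
    rw [← this]
    refine integral_congr_ae (Eventually.of_forall fun ω => ?_)
    simp [← Complex.exp_conj]
  have hconji : ∀ ξ : ℝ, Integrable (fun ω => (starRingEnd ℂ) (h ω) *
      Complex.exp ((φ ω : ℝ) * ξ * Complex.I)) m := by
    intro ξ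
    have : Measurable fun ω => Complex.exp ((φ ω : ℝ) * ξ * Complex.I) := by fun_prop
    refine Integrable.mul_bdd (c := 1) ?_ this.aestronglyMeasurable
      (Eventually.of_forall fun ω => ?_)
    · exact (RCLike.conjCLE (K := ℂ)).toContinuousLinearMap.integrable_comp hh
    · rw [← Complex.ofReal_mul, Complex.norm_exp_ofReal_mul_I]
  have hre := integral_smul_eq_zero_of_charFun_real m hh.re hφ (fun ξ => by
    have : ∀ ω, ((RCLike.re (h ω) : ℝ) : ℂ) * Complex.exp ((φ ω : ℝ) * ξ * Complex.I) =
      (1 / 2 : ℂ) * (h ω * Complex.exp ((φ ω : ℝ) * ξ * Complex.I) +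
        (starRingEnd ℂ) (h ω) * Complex.exp ((φ ω : ℝ) * ξ * Complex.I)) := by
      intro ω
      have := Complex.re_eq_add_conj (h ω)
      simp only [RCLike.re_to_complex]
      rw [this]; ring
    simp_rw [this]
    rw [integral_const_mul, integral_add (hexpi ξ) (hconji ξ), hbd, hconj]
    simp) hF hC
  have him := integral_smul_eq_zero_of_charFun_real m hh.im hφ (fun ξ => by
    have : ∀ ω, ((RCLike.im (h ω) : ℝ) : ℂ) * Complex.exp ((φ ω : ℝ) * ξ * Complex.I) =
      (1 / (2 * Complex.I) : ℂ) * (h ω * Complex.exp ((φ ω : ℝ) * ξ * Complex.I) -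
        (starRingEnd ℂ) (h ω) * Complex.exp ((φ ω : ℝ) * ξ * Complex.I)) := by
      intro ω
      have := Complex.im_eq_sub_conj (h ω)
      simp only [RCLike.im_to_complex]
      rw [this]; ring
    simp_rw [this]
    rw [integral_const_mul, integral_sub (hexpi ξ) (hconji ξ), hbd, hconj]
    simp) hF hC
  have hFm : AEStronglyMeasurable (fun ω => F (φ ω)) m :=
    (hF.comp_measurable hφ).aestronglyMeasurable
  have hi1 : Integrable (fun ω => ((RCLike.re (h ω) : ℝ) : ℂ) • F (φ ω)) m :=
    hh.re.ofReal.smul_bdd C hFm (Eventually.of_forall fun ω => hC _)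
  have hi2 : Integrable (fun ω => ((RCLike.im (h ω) : ℝ) : ℂ) • F (φ ω)) m :=
    hh.im.ofReal.smul_bdd C hFm (Eventually.of_forall fun ω => hC _)
  have : ∀ ω, h ω • F (φ ω) = ((RCLike.re (h ω) : ℝ) : ℂ) • F (φ ω) +
      Complex.I • (((RCLike.im (h ω) : ℝ) : ℂ) • F (φ ω)) := by
    intro ω
    rw [smul_smul, ← add_smul]
    congr 1
    simp only [RCLike.re_to_complex, RCLike.im_to_complex]
    rw [mul_comm, Complex.re_add_im]
  simp_rw [this]
  have hi3 : Integrable (fun ω => Complex.I • (((RCLike.im (h ω) : ℝ) : ℂ) • F (φ ω))) m :=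
    hi2.smul Complex.I
  rw [integral_add hi1 hi3, integral_smul, hre, him]
  simp

end Uniqueness

/-! ### Multiplicativity of the Hille-Phillips calculus -/

section HillePhillips

/-- `c` is the image under `φ` of the complex measure with density `h` relative to `m`. -/
structure HasDensity {α Ω : Type*} [MeasurableSpace α] [MeasurableSpace Ω] (c : ComplexMeasure α)
    (m : Measure Ω) (h : Ω → ℂ) (φ : Ω → α) : Prop where
  integrable : Integrable h m
  measurable : Measurable φ
  apply : ∀ s, MeasurableSet s → c s = ∫ ω in φ ⁻¹' s, h ω ∂m

variable {X : Type*} [NormedAddCommGroup X] [NormedSpace ℂ X] [CompleteSpace X]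
  {Ω Ω' : Type*} [MeasurableSpace Ω] [MeasurableSpace Ω']

theorem HasDensity.laplace_eq {c : ComplexMeasure ℝ≥0} {m : Measure Ω} {h : Ω → ℂ} {φ : Ω → ℝ≥0}
    (H : HasDensity c m h φ) {z : ℂ} (hz : 0 ≤ z.re) :
    laplace c z = ∫ ω, h ω * Complex.exp (-((φ ω : ℝ) : ℂ) * z) ∂m := by
  have hm : StronglyMeasurable fun s : ℝ≥0 => Complex.exp (-((s : ℝ) : ℂ) * z) := by
    have : Continuous fun s : ℝ≥0 => Complex.exp (-((s : ℝ) : ℂ) * z) := by fun_prop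
    exact this.stronglyMeasurable
  exact cmIntegral_eq_integral_density c m H.integrable H.measurable H.apply hm
    fun s => norm_cexp_neg_mul_le s hz

omit [CompleteSpace X] in
theorem BoundedC0Semigroup.exists_norm_orbit_le (T : BoundedC0Semigroup X) :
    ∃ M : ℝ, 0 ≤ M ∧ ∀ t x, ‖T.toFun t x‖ ≤ M * ‖x‖ := by
  obtain ⟨M, hM⟩ := T.bounded
  exact ⟨M, (norm_nonneg _).trans (hM 0), fun t x => (T.toFun t).le_of_opNorm_le (hM t) x⟩

omit [CompleteSpace X] in
theorem BoundedC0Semigroup.stronglyMeasurable_orbit (T : BoundedC0Semigroup X) (x : X) :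
    StronglyMeasurable fun t => T.toFun t x := (T.continuous_orbit x).stronglyMeasurable

theorem HasDensity.hillePhillips_eq {c : ComplexMeasure ℝ≥0} {m : Measure Ω} {h : Ω → ℂ}
    {φ : Ω → ℝ≥0} (H : HasDensity c m h φ) (T : BoundedC0Semigroup X) (x : X) :
    hillePhillips T c x = ∫ ω, h ω • T.toFun (φ ω) x ∂m := by
  obtain ⟨M, -, hM⟩ := T.exists_norm_orbit_le
  exact cmIntegral_eq_integral_density c m H.integrable H.measurable H.apply
    (T.stronglyMeasurable_orbit x) fun s => hM s x

omit [CompleteSpace X] in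
theorem HasDensity.integrable_orbit {c : ComplexMeasure ℝ≥0} {m : Measure Ω} {h : Ω → ℂ}
    {φ : Ω → ℝ≥0} (H : HasDensity c m h φ) (T : BoundedC0Semigroup X) (x : X) :
    Integrable (fun ω => h ω • T.toFun (φ ω) x) m := by
  obtain ⟨M, -, hM⟩ := T.exists_norm_orbit_le
  exact H.integrable.smul_bdd _ ((T.stronglyMeasurable_orbit x).comp_measurable
    H.measurable).aestronglyMeasurable (Eventually.of_forall fun ω => hM _ x)

/-- The free parameter space lets one construction produce convolutions (product space, `φ` the
addition) as well as exponential distributions and their mixtures. -/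
theorem exists_hasDensity (m : Measure Ω) {h : Ω → ℂ} (hh : Integrable h m) {φ : Ω → ℝ≥0}
    (hφ : Measurable φ) : ∃ c : ComplexMeasure ℝ≥0, HasDensity c m h φ := by
  obtain ⟨c, hc⟩ := exists_complexMeasure_density m hh hφ
  exact ⟨c, hh, hφ, hc⟩

theorem exists_hasDensity_id (c : ComplexMeasure ℝ≥0) {m : Measure ℝ≥0} [IsFiniteMeasure m]
    (hm : c.variation ≤ m) : ∃ h : ℝ≥0 → ℂ, HasDensity c m h id := by
  obtain ⟨h, hh, hc⟩ := exists_density_of_variation_le c m hm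
  exact ⟨h, hh, measurable_id, hc⟩

theorem HasDensity.laplace_mul {c d : ComplexMeasure ℝ≥0} {m : Measure Ω} {n : Measure Ω'}
    [SFinite m] [SFinite n] {h : Ω → ℂ} {k : Ω' → ℂ} {φ : Ω → ℝ≥0} {ψ : Ω' → ℝ≥0}
    (H : HasDensity c m h φ) (K : HasDensity d n k ψ) {z : ℂ} (hz : 0 ≤ z.re) :
    laplace c z * laplace d z = ∫ p, h p.1 * k p.2 *
      Complex.exp (-(((φ p.1 + ψ p.2 : ℝ≥0) : ℝ) : ℂ) * z) ∂(m.prod n) := by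
  rw [H.laplace_eq hz, K.laplace_eq hz, ← integral_prod_mul]
  refine integral_congr_ae (Eventually.of_forall fun p => ?_)
  have : -(((φ p.1 + ψ p.2 : ℝ≥0) : ℝ) : ℂ) * z = -((φ p.1 : ℝ) : ℂ) * z + -((ψ p.2 : ℝ) : ℂ) * z := by
    push_cast; ring
  simp only [this, Complex.exp_add]
  ring

/-- Fubini and the semigroup law: the composition integrates the orbit against the image of the
product measure under addition. -/
theorem HasDensity.hillePhillips_comp {c d : ComplexMeasure ℝ≥0} {m : Measure Ω} {n : Measure Ω'}
    [SFinite m] [SFinite n] {h : Ω → ℂ} {k : Ω' → ℂ} {φ : Ω → ℝ≥0} {ψ : Ω' → ℝ≥0}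
    (H : HasDensity c m h φ) (K : HasDensity d n k ψ) (T : BoundedC0Semigroup X) (x : X) :
    hillePhillips T c (hillePhillips T d x) = ∫ p, (h p.1 * k p.2) •
      T.toFun (φ p.1 + ψ p.2) x ∂(m.prod n) := by
  obtain ⟨M, -, hM⟩ := T.exists_norm_orbit_le
  rw [H.hillePhillips_eq, K.hillePhillips_eq, integral_prod]
  · refine integral_congr_ae (Eventually.of_forall fun ω => ?_)
    simp only [mul_smul]
    rw [integral_smul, ← (T.toFun (φ ω)).integral_comp_comm (K.integrable_orbit T x)]
    simp [T.map_add]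
  · refine (H.integrable.mul_prod K.integrable).smul_bdd (M * ‖x‖)
      ((T.stronglyMeasurable_orbit x).comp_measurable ?_).aestronglyMeasurable
      (Eventually.of_forall fun ω => hM _ x)
    exact (H.measurable.comp measurable_fst).add (K.measurable.comp measurable_snd)

/-- The Hille-Phillips calculus is multiplicative: products of operators only depend on the
products of the Laplace transforms. -/
theorem hillePhillips_comp_congr {c₁ d₁ c₂ d₂ : ComplexMeasure ℝ≥0}
    (hL : ∀ z : ℂ, 0 < z.re → laplace c₁ z * laplace d₁ z = laplace c₂ z * laplace d₂ z)
    (T : BoundedC0Semigroup X) (x : X) :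
    hillePhillips T c₁ (hillePhillips T d₁ x) = hillePhillips T c₂ (hillePhillips T d₂ x) := by
  -- A common dominating measure puts both product densities on the same space, where they can be
  -- subtracted.
  set m : Measure ℝ≥0 := c₁.variation + d₁.variation + (c₂.variation + d₂.variation) with hm
  have le1 : c₁.variation ≤ m :=
    (Measure.le_add_right le_rfl).trans (Measure.le_add_right le_rfl)
  have le2 : d₁.variation ≤ m :=
    (Measure.le_add_left le_rfl).trans (Measure.le_add_right le_rfl)
  have le3 : c₂.variation ≤ m :=
    (Measure.le_add_right le_rfl).trans (Measure.le_add_left le_rfl)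
  have le4 : d₂.variation ≤ m :=
    (Measure.le_add_left le_rfl).trans (Measure.le_add_left le_rfl)
  obtain ⟨h₁, H₁⟩ := exists_hasDensity_id c₁ le1
  obtain ⟨k₁, K₁⟩ := exists_hasDensity_id d₁ le2
  obtain ⟨h₂, H₂⟩ := exists_hasDensity_id c₂ le3
  obtain ⟨k₂, K₂⟩ := exists_hasDensity_id d₂ le4
  obtain ⟨M, -, hM⟩ := T.exists_norm_orbit_le
  have i1 := H₁.integrable.mul_prod K₁.integrable
  have i2 := H₂.integrable.mul_prod K₂.integrable
  have hadd : Measurable fun p : ℝ≥0 × ℝ≥0 => id p.1 + id p.2 := by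
    simp only [id]; fun_prop
  have hexp : ∀ z : ℂ, AEStronglyMeasurable (fun p : ℝ≥0 × ℝ≥0 =>
      Complex.exp (-(((id p.1 + id p.2 : ℝ≥0) : ℝ) : ℂ) * z)) (m.prod m) := by
    intro z
    have : Continuous fun p : ℝ≥0 × ℝ≥0 =>
      Complex.exp (-(((id p.1 + id p.2 : ℝ≥0) : ℝ) : ℂ) * z) := by simp only [id]; fun_prop
    exact this.aestronglyMeasurable
  have key := integral_smul_eq_zero_of_laplace (m.prod m) (i1.sub i2) hadd (fun z hz => by
    simp only [Pi.sub_apply, sub_mul]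
    rw [integral_sub, ← H₁.laplace_mul K₁ hz.le, ← H₂.laplace_mul K₂ hz.le, hL z hz, sub_self]
    · exact i1.mul_bdd (c := 1) (hexp z)
        (Eventually.of_forall fun p => norm_cexp_neg_mul_le _ hz.le)
    · exact i2.mul_bdd (c := 1) (hexp z)
        (Eventually.of_forall fun p => norm_cexp_neg_mul_le _ hz.le))
    (T.stronglyMeasurable_orbit x) (fun t => hM t x)
  rw [H₁.hillePhillips_comp K₁, H₂.hillePhillips_comp K₂, ← sub_eq_zero, ← key, ← integral_sub]
  · simp only [Pi.sub_apply, sub_smul]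
  · exact i1.smul_bdd (M * ‖x‖)
      ((T.stronglyMeasurable_orbit x).comp_measurable hadd).aestronglyMeasurable
      (Eventually.of_forall fun ω => hM _ x)
  · exact i2.smul_bdd (M * ‖x‖)
      ((T.stronglyMeasurable_orbit x).comp_measurable hadd).aestronglyMeasurable
      (Eventually.of_forall fun ω => hM _ x)

/-- The convolution of two complex measures. -/
theorem exists_complexMeasure_conv (c d : ComplexMeasure ℝ≥0) :
    ∃ e : ComplexMeasure ℝ≥0, (∀ z : ℂ, 0 ≤ z.re → laplace e z = laplace c z * laplace d z) ∧
      ∀ {X : Type _} [NormedAddCommGroup X] [NormedSpace ℂ X] [CompleteSpace X]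
        (T : BoundedC0Semigroup X) (x : X),
        hillePhillips T e x = hillePhillips T c (hillePhillips T d x) := by
  obtain ⟨h, H⟩ := exists_hasDensity_id c (le_refl c.variation)
  obtain ⟨k, K⟩ := exists_hasDensity_id d (le_refl d.variation)
  have hadd : Measurable fun p : ℝ≥0 × ℝ≥0 => id p.1 + id p.2 := by
    simp only [id]; fun_prop
  obtain ⟨e, he⟩ := exists_hasDensity (c.variation.prod d.variation)
    (H.integrable.mul_prod K.integrable) hadd
  refine ⟨e, fun z hz => ?_, fun T x => ?_⟩
  · rw [H.laplace_mul K hz, he.laplace_eq hz]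
  · rw [H.hillePhillips_comp K, he.hillePhillips_eq]

/-- The operator defined by a regularizer may be computed with any other pair of measures having
the same quotient of Laplace transforms. -/
theorem Regularizer.op_apply_of_mem_range {T : BoundedC0Semigroup X} {g : ℂ → ℂ}
    (R : Regularizer T g) {μ ν : ComplexMeasure ℝ≥0}
    (hL : ∀ z : ℂ, 0 < z.re → laplace ν z = laplace μ z * g z) {x y : X}
    (hx : hillePhillips T μ y = x) :
    ∃ h : x ∈ R.op.domain, R.op ⟨x, h⟩ = hillePhillips T ν y := by
  -- Cross-multiplication: the transforms of `R.ν` times `μ` and of `R.μ` times `ν` both equal the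
  -- product of those of `R.μ` and `μ` with `g`.
  have h1 : hillePhillips T R.ν x = hillePhillips T R.μ (hillePhillips T ν y) := by
    rw [← hx]
    refine hillePhillips_comp_congr (fun z hz => ?_) T y
    rw [hL z hz, R.laplace_eq z hz]; ring
  refine ⟨⟨_, h1.symm⟩, ?_⟩
  change (LinearEquiv.ofInjective (hillePhillips T R.μ) R.injective).symm _ = _
  rw [LinearEquiv.symm_apply_eq]
  exact Subtype.ext h1

end HillePhillips

/-! ### The resolvent at 1 as a Laplace integral -/

section Resolvent

variable {X : Type*} [NormedAddCommGroup X] [NormedSpace ℂ X] [CompleteSpace X]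

theorem integrableOn_cexp_neg : IntegrableOn (fun s : ℝ => ((Real.exp (-s) : ℝ) : ℂ)) (Set.Ioi 0) :=
  (integrableOn_exp_neg_Ioi 0).ofReal

/-- The exponential distribution has Laplace transform `(1 + z)⁻¹`. -/
theorem integral_exp_neg_mul_cexp {z : ℂ} (hz : 0 ≤ z.re) :
    ∫ s in Set.Ioi (0 : ℝ), ((Real.exp (-s) : ℝ) : ℂ) *
      Complex.exp (-((s.toNNReal : ℝ) : ℂ) * z) = (1 + z)⁻¹ := by
  have h1 : (-(1 + z)).re < 0 := by simp; linarith
  have := integral_exp_mul_complex_Ioi h1 0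
  simp only [Complex.ofReal_zero, mul_zero, Complex.exp_zero] at this
  rw [show (1 + z)⁻¹ = -1 / -(1 + z) by rw [neg_div_neg_eq, one_div], ← this]
  refine setIntegral_congr_fun measurableSet_Ioi fun s hs => ?_
  have hs : (0 : ℝ) < s := hs
  simp only [Real.coe_toNNReal s hs.le, Complex.ofReal_exp, ← Complex.exp_add]
  congr 1
  push_cast
  ring

/-- The integral representation of the resolvent `(1 + A)⁻¹`. -/
noncomputable def resolventIntegral (T : BoundedC0Semigroup X) (x : X) : X :=
  ∫ s in Set.Ioi (0 : ℝ), ((Real.exp (-s) : ℝ) : ℂ) • T.toFun s.toNNReal x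

omit [CompleteSpace X] in
theorem BoundedC0Semigroup.continuous_weighted_orbit (T : BoundedC0Semigroup X) (x : X) :
    Continuous fun s : ℝ => ((Real.exp (-s) : ℝ) : ℂ) • T.toFun s.toNNReal x := by
  have h1 : Continuous fun s : ℝ => T.toFun s.toNNReal x :=
    (T.continuous_orbit x).comp continuous_real_toNNReal
  have h2 : Continuous fun s : ℝ => ((Real.exp (-s) : ℝ) : ℂ) := by fun_prop
  exact h2.smul h1

omit [CompleteSpace X] in
theorem BoundedC0Semigroup.integrableOn_weighted_orbit (T : BoundedC0Semigroup X) (x : X) :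
    IntegrableOn (fun s : ℝ => ((Real.exp (-s) : ℝ) : ℂ) • T.toFun s.toNNReal x) (Set.Ioi 0) := by
  obtain ⟨M, -, hM⟩ := T.exists_norm_orbit_le
  have h1 : Continuous fun s : ℝ => T.toFun s.toNNReal x :=
    (T.continuous_orbit x).comp continuous_real_toNNReal
  exact integrableOn_cexp_neg.integrable.smul_bdd (M * ‖x‖) h1.aestronglyMeasurable
    (Eventually.of_forall fun s => hM _ x)

omit [CompleteSpace X] in
-- The generator is a right limit at `0`, and `T s = T t ∘ T (s - t)` for `s > t` moves it to `t`. A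
-- right derivative is enough for the fundamental theorem of calculus, the orbit being continuous.
theorem IsGenerator.hasDerivWithinAt_orbit {T : BoundedC0Semigroup X} {A : X →ₗ.[ℂ] X}
    (hA : IsGenerator T (-A)) (x : A.domain) {t : ℝ} (ht : 0 ≤ t) :
    HasDerivWithinAt (fun s : ℝ => T.toFun s.toNNReal x) (-T.toFun t.toNNReal (A x))
      (Set.Ioi t) t := by
  have h1 : ((x : X), -(A x)) ∈ (-A).graph := by
    rw [LinearPMap.mem_graph_iff]
    exact ⟨x, rfl, rfl⟩
  have h2 := (hA _ _).1 h1
  have h3 : Tendsto (fun s : ℝ => (s - t).toNNReal) (𝓝[>] t) (𝓝[>] 0) := by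
    refine tendsto_nhdsWithin_iff.2 ⟨?_, ?_⟩
    · have : Continuous fun s : ℝ => (s - t).toNNReal := by fun_prop
      exact (this.tendsto' t 0 (by simp)).mono_left nhdsWithin_le_nhds
    · filter_upwards [self_mem_nhdsWithin] with s hs
      simpa using hs
  have h4 := ((T.toFun t.toNNReal).continuous.tendsto _).comp (h2.comp h3)
  rw [hasDerivWithinAt_iff_tendsto_slope' Set.self_notMem_Ioi]
  rw [map_neg] at h4
  refine h4.congr' ?_
  filter_upwards [self_mem_nhdsWithin] with s hs
  have hs : t < s := hs
  have e : s.toNNReal = t.toNNReal + (s - t).toNNReal := by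
    rw [← Real.toNNReal_add ht (by linarith)]; congr 1; ring
  simp only [Function.comp, slope_def_module]
  rw [e, T.map_add, Real.coe_toNNReal _ (by linarith : 0 ≤ s - t)]
  rw [ContinuousLinearMap.comp_apply, ← map_sub, ContinuousLinearMap.map_smul_of_tower]

/-- `(1 + A)⁻¹ (1 + A) x = x`. -/
theorem IsGenerator.resolventIntegral_add {T : BoundedC0Semigroup X} {A : X →ₗ.[ℂ] X}
    (hA : IsGenerator T (-A)) (x : A.domain) : resolventIntegral T (x + A x) = x := by
  obtain ⟨M, -, hM⟩ := T.exists_norm_orbit_le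
  -- `e^{-s} T(s) x` has right derivative `-e^{-s} T(s)(x + A x)`, equals `x` at `0` and tends to
  -- `0` at infinity.
  have hderiv : ∀ t : ℝ, 0 ≤ t → HasDerivWithinAt
      (fun s : ℝ => ((Real.exp (-s) : ℝ) : ℂ) • T.toFun s.toNNReal x)
      (-(((Real.exp (-t) : ℝ) : ℂ) • T.toFun t.toNNReal (x + A x))) (Set.Ioi t) t := by
    intro t ht
    have h1 : HasDerivAt (fun s : ℝ => Real.exp (-s)) (-Real.exp (-t)) t := by
      simpa using (hasDerivAt_neg t).exp
    have h2 := h1.hasDerivWithinAt.smul (hA.hasDerivWithinAt_orbit x ht)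
    simp only [Complex.coe_smul]
    refine h2.congr_deriv ?_
    rw [map_add]
    module
  have hFTC : ∀ b : ℝ, 0 ≤ b →
      ∫ s in (0 : ℝ)..b, ((Real.exp (-s) : ℝ) : ℂ) • T.toFun s.toNNReal (x + A x) =
        x - ((Real.exp (-b) : ℝ) : ℂ) • T.toFun b.toNNReal x := by
    intro b hb
    have := intervalIntegral.integral_eq_sub_of_hasDeriv_right
      (a := 0) (b := b) (T.continuous_weighted_orbit (x : X)).continuousOn
      (fun t ht => hderiv t (by rw [min_eq_left hb] at ht; exact ht.1.le))
      ((T.continuous_weighted_orbit (x + A x)).neg.intervalIntegrable _ _)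
    rw [intervalIntegral.integral_neg] at this
    rw [← neg_inj, this]
    simp [T.map_zero]
  have h1 := intervalIntegral_tendsto_integral_Ioi 0
    (T.integrableOn_weighted_orbit (x + A x)) tendsto_id
  have h2 : Tendsto (fun b : ℝ => (x : X) - ((Real.exp (-b) : ℝ) : ℂ) • T.toFun b.toNNReal x)
      atTop (𝓝 (x - 0)) := by
    refine tendsto_const_nhds.sub ?_
    have h3 : Tendsto (fun b : ℝ => Real.exp (-b) * (M * ‖(x : X)‖)) atTop (𝓝 0) := by
      simpa using (Real.tendsto_exp_neg_atTop_nhds_zero).mul_const (M * ‖(x : X)‖)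
    refine squeeze_zero_norm (fun b => ?_) h3
    rw [norm_smul, Complex.norm_real, Real.norm_eq_abs, abs_of_pos (Real.exp_pos _)]
    exact mul_le_mul_of_nonneg_left (hM _ _) (Real.exp_pos _).le
  rw [sub_zero] at h2
  refine tendsto_nhds_unique h1 (h2.congr' ?_)
  filter_upwards [eventually_ge_atTop 0] with b hb
  exact (hFTC b hb).symm

/-- The resolvent is injective. -/
theorem resolventIntegral_eq_zero {T : BoundedC0Semigroup X} {x : X}
    (hx : resolventIntegral T x = 0) : x = 0 := by
  set u : ℝ → X := fun s => ((Real.exp (-s) : ℝ) : ℂ) • T.toFun s.toNNReal x with hu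
  have hint := T.integrableOn_weighted_orbit x
  -- By translation and the semigroup law, the tail integral from `t` is `e^{-t} T(t)` applied to
  -- the full integral, which is zero.
  have htail : ∀ t : ℝ, 0 ≤ t → ∫ s in Set.Ioi t, u s = 0 := by
    intro t ht
    have e1 : ∫ s in Set.Ioi t, u s = ∫ s in Set.Ioi (0 : ℝ), u (s + t) := by
      rw [← (measurePreserving_add_right volume t).setIntegral_preimage_emb
        (measurableEmbedding_addRight t) u (Set.Ioi t), Set.preimage_add_const_Ioi, sub_self]
    rw [e1]
    have e2 : ∀ s ∈ Set.Ioi (0 : ℝ), u (s + t) = ((Real.exp (-t) : ℝ) : ℂ) •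
        T.toFun t.toNNReal (u s) := by
      intro s hs
      have hs : (0 : ℝ) < s := hs
      simp only [hu]
      rw [map_smul, smul_smul, ← Complex.ofReal_mul, ← Real.exp_add, add_comm s t,
        Real.toNNReal_add ht hs.le, T.map_add, ContinuousLinearMap.comp_apply, neg_add]
    rw [setIntegral_congr_fun measurableSet_Ioi e2, integral_smul,
      ContinuousLinearMap.integral_comp_comm _ hint]
    have : ∫ s in Set.Ioi (0 : ℝ), u s = 0 := hx
    rw [this, map_zero, smul_zero]
  have hzero : ∀ t : ℝ, 0 ≤ t → ∫ s in (0 : ℝ)..t, u s = 0 := by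
    intro t ht
    rw [intervalIntegral.integral_of_le ht]
    have h3 : ∫ s in Set.Ioi (0 : ℝ), u s = (∫ s in Set.Ioc 0 t, u s) + ∫ s in Set.Ioi t, u s := by
      rw [← setIntegral_union (Set.Ioc_disjoint_Ioi le_rfl) measurableSet_Ioi
        (hint.mono_set Set.Ioc_subset_Ioi_self) (hint.mono_set (Set.Ioi_subset_Ioi ht)),
        Set.Ioc_union_Ioi_eq_Ioi ht]
    rw [htail t ht, htail 0 le_rfl, add_zero] at h3
    exact h3.symm
  have hcont := T.continuous_weighted_orbit x
  -- The primitive of `u` vanishes on `[0, ∞)`, so its right derivative at `0`, which is `u 0 = x`,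
  -- is zero.
  have hd : HasDerivWithinAt (fun t => ∫ s in (0 : ℝ)..t, u s) (u 0) (Set.Ici 0) 0 :=
    (intervalIntegral.integral_hasDerivAt_right (hcont.intervalIntegrable _ _)
      (hcont.stronglyMeasurableAtFilter _ _) hcont.continuousAt).hasDerivWithinAt
  have hd0 : HasDerivWithinAt (fun t => ∫ s in (0 : ℝ)..t, u s) 0 (Set.Ici 0) 0 :=
    (hasDerivWithinAt_const (0 : ℝ) (Set.Ici 0) (0 : X)).congr (fun t ht => hzero t ht)
      (hzero 0 le_rfl)
  have := (uniqueDiffWithinAt_Ici (0 : ℝ)).eq_deriv _ hd hd0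
  simpa [hu, T.map_zero] using this

/-- The measure with Laplace transform `(1 + z)⁻²` and its image in the calculus. -/
theorem exists_laplace_eq_inv_sq :
    ∃ μ : ComplexMeasure ℝ≥0, (∀ z : ℂ, 0 < z.re → laplace μ z = (1 + z)⁻¹ * (1 + z)⁻¹) ∧
      ∀ {X : Type _} [NormedAddCommGroup X] [NormedSpace ℂ X] [CompleteSpace X]
        (T : BoundedC0Semigroup X) (x : X),
        hillePhillips T μ x = resolventIntegral T (resolventIntegral T x) := by
  -- `c` is the exponential distribution; `μ` is its convolution square.
  obtain ⟨c, hc⟩ := exists_hasDensity (volume.restrict (Set.Ioi (0 : ℝ)))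
    integrableOn_cexp_neg measurable_real_toNNReal
  obtain ⟨μ, h1, h2⟩ := exists_complexMeasure_conv c c
  refine ⟨μ, fun z hz => ?_, fun T x => ?_⟩
  · rw [h1 z hz.le, hc.laplace_eq hz.le, integral_exp_neg_mul_cexp hz.le]
  · rw [h2, hc.hillePhillips_eq, hc.hillePhillips_eq]
    rfl

end Resolvent

/-! ## Laplace transforms of complex measures -/

/-- `F` is the Laplace transform of a complex measure on `{Re z > 0}`. -/
def IsLaplaceTransform (F : ℂ → ℂ) : Prop :=
  ∃ c : ComplexMeasure ℝ≥0, ∀ z : ℂ, 0 < z.re → laplace c z = F z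

theorem IsLaplaceTransform.congr {F G : ℂ → ℂ} (hF : IsLaplaceTransform F)
    (h : ∀ z : ℂ, 0 < z.re → F z = G z) : IsLaplaceTransform G := by
  obtain ⟨c, hc⟩ := hF
  exact ⟨c, fun z hz => (hc z hz).trans (h z hz)⟩

theorem IsLaplaceTransform.mul {F G : ℂ → ℂ} (hF : IsLaplaceTransform F)
    (hG : IsLaplaceTransform G) : IsLaplaceTransform fun z => F z * G z := by
  obtain ⟨c, hc⟩ := hF
  obtain ⟨d, hd⟩ := hG
  obtain ⟨e, he, -⟩ := exists_complexMeasure_conv.{0} c d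
  exact ⟨e, fun z hz => by rw [he z hz.le, hc z hz, hd z hz]⟩

theorem IsLaplaceTransform.add {F G : ℂ → ℂ} (hF : IsLaplaceTransform F)
    (hG : IsLaplaceTransform G) : IsLaplaceTransform fun z => F z + G z := by
  obtain ⟨c, hc⟩ := hF
  obtain ⟨d, hd⟩ := hG
  refine ⟨c + d, fun z hz => ?_⟩
  have hi : ∀ c : ComplexMeasure ℝ≥0,
      c.Integrable fun s : ℝ≥0 => Complex.exp (-((s : ℝ) : ℂ) * z) := by
    intro c
    have : Continuous fun s : ℝ≥0 => Complex.exp (-((s : ℝ) : ℂ) * z) := by fun_prop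
    exact Integrable.of_bound (C := 1) this.aestronglyMeasurable
      (Eventually.of_forall fun s => norm_cexp_neg_mul_le s hz.le)
  simp only [← hc z hz, ← hd z hz]
  exact VectorMeasure.integral_add_vectorMeasure (hi c) (hi d)

theorem isLaplaceTransform_of_density {Ω : Type*} [MeasurableSpace Ω] (m : Measure Ω) {h : Ω → ℂ}
    (hh : Integrable h m) {φ : Ω → ℝ≥0} (hφ : Measurable φ) :
    IsLaplaceTransform fun z => ∫ ω, h ω * Complex.exp (-((φ ω : ℝ) : ℂ) * z) ∂m := by
  obtain ⟨c, hc⟩ := exists_hasDensity m hh hφ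
  exact ⟨c, fun z hz => hc.laplace_eq hz.le⟩

theorem isLaplaceTransform_const (a : ℂ) : IsLaplaceTransform fun _ => a := by
  refine (isLaplaceTransform_of_density (Measure.dirac ()) (h := fun _ => a) (φ := fun _ => 0)
    (integrable_const a) measurable_const).congr fun z _ => ?_
  simp

/-- Mixtures of exponential distributions. -/
theorem isLaplaceTransform_integral_inv {K : Type*} [MeasurableSpace K] (σ : Measure K)
    [IsFiniteMeasure σ] {r : K → ℝ≥0} (hr : Measurable r) :
    IsLaplaceTransform fun z => ∫ θ, (1 + ((r θ : ℝ) : ℂ) * z)⁻¹ ∂σ := by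
  have hint : Integrable (fun p : K × ℝ => (1 : ℂ) * ((Real.exp (-p.2) : ℝ) : ℂ))
      (σ.prod (volume.restrict (Set.Ioi 0))) :=
    Integrable.mul_prod (integrable_const (1 : ℂ)) integrableOn_cexp_neg
  -- Scaling an exponential variable by `r` changes its transform to `(1 + rz)⁻¹`; the case `r = 0`
  -- is an atom at the origin.
  have hφ : Measurable fun p : K × ℝ => r p.1 * p.2.toNNReal := by fun_prop
  refine (isLaplaceTransform_of_density _ hint hφ).congr fun z hz => ?_
  rw [integral_prod]
  · refine integral_congr_ae (Eventually.of_forall fun θ => ?_)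
    have hz' : 0 ≤ (((r θ : ℝ) : ℂ) * z).re := by
      rw [Complex.re_ofReal_mul]; positivity
    simp only [← integral_exp_neg_mul_cexp hz']
    refine integral_congr_ae (Eventually.of_forall fun s => ?_)
    simp only [one_mul]
    congr 2
    push_cast
    ring
  · have : Measurable fun p : K × ℝ =>
      Complex.exp (-(((r p.1 * p.2.toNNReal : ℝ≥0) : ℝ) : ℂ) * z) := by fun_prop
    exact hint.mul_bdd (c := 1) this.aestronglyMeasurable
      (Eventually.of_forall fun p => norm_cexp_neg_mul_le _ hz.le)

theorem isLaplaceTransform_inv_one_add : IsLaplaceTransform fun z => (1 + z)⁻¹ := by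
  refine (isLaplaceTransform_integral_inv (Measure.dirac ()) (r := fun _ => 1)
    measurable_const).congr fun z _ => ?_
  simp

/-- Laplace transforms are holomorphic on the right half-plane. -/
theorem IsLaplaceTransform.differentiableOn {F : ℂ → ℂ} (hF : IsLaplaceTransform F) :
    DifferentiableOn ℂ F {z | 0 < z.re} := by
  obtain ⟨c, hc⟩ := hF
  obtain ⟨h, H⟩ := exists_hasDensity_id c (le_refl c.variation)
  have hopen : IsOpen {z : ℂ | 0 < z.re} := isOpen_lt continuous_const Complex.continuous_re
  suffices hD : DifferentiableOn ℂ (fun z : ℂ => ∫ s : ℝ≥0, h s *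
      Complex.exp (-((s : ℝ) : ℂ) * z) ∂c.variation) {z | 0 < z.re} by
    exact hD.congr fun z hz => by rw [← hc z hz, H.laplace_eq (le_of_lt hz)]; rfl
  intro z₀ hz₀
  have hz₀ : 0 < z₀.re := hz₀
  have hm : ∀ z : ℂ, AEStronglyMeasurable (fun s : ℝ≥0 =>
      Complex.exp (-((s : ℝ) : ℂ) * z)) c.variation := by
    intro z
    have : Continuous fun s : ℝ≥0 => Complex.exp (-((s : ℝ) : ℂ) * z) := by fun_prop
    exact this.aestronglyMeasurable
  have hs : Continuous fun s : ℝ≥0 => -((s : ℝ) : ℂ) := by fun_prop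
  -- On `U`, `y ≤ e^y` gives `s e^{-s Re z} ≤ 2 / Re z₀`, a majorant uniform in `s`.
  set U : Set ℂ := {z | z₀.re / 2 < z.re} with hU
  have hUo : IsOpen U := isOpen_lt continuous_const Complex.continuous_re
  have hUm : U ∈ 𝓝 z₀ := hUo.mem_nhds (by simp only [hU, Set.mem_ofPred_eq]; linarith)
  have := hasDerivAt_integral_of_dominated_loc_of_deriv_le (μ := c.variation)
    (F := fun (z : ℂ) (s : ℝ≥0) => h s * Complex.exp (-((s : ℝ) : ℂ) * z))
    (F' := fun (z : ℂ) (s : ℝ≥0) => h s * (Complex.exp (-((s : ℝ) : ℂ) * z) * -((s : ℝ) : ℂ)))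
    (x₀ := z₀) (s := U) (bound := fun s => ‖h s‖ * (2 / z₀.re)) hUm
    (Eventually.of_forall fun z => H.integrable.aestronglyMeasurable.mul (hm z))
    (H.integrable.mul_bdd (c := 1) (hm z₀)
      (Eventually.of_forall fun s => norm_cexp_neg_mul_le s hz₀.le))
    (H.integrable.aestronglyMeasurable.mul ((hm z₀).mul hs.aestronglyMeasurable))
    (Eventually.of_forall fun s z hz => by
      have hz : z₀.re / 2 < z.re := hz
      rw [norm_mul]
      refine mul_le_mul_of_nonneg_left ?_ (norm_nonneg _)
      rw [norm_mul, norm_neg, Complex.norm_real, Real.norm_eq_abs, NNReal.abs_eq, Complex.norm_exp]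
      have hre : (-((s : ℝ) : ℂ) * z).re = -((s : ℝ) * z.re) := by simp
      rw [hre, Real.exp_neg, inv_mul_le_iff₀ (Real.exp_pos _)]
      have h1 : (s : ℝ) * z.re ≤ Real.exp ((s : ℝ) * z.re) := by
        linarith [Real.add_one_le_exp ((s : ℝ) * z.re)]
      have h2 : (s : ℝ) * (z₀.re / 2) ≤ (s : ℝ) * z.re :=
        mul_le_mul_of_nonneg_left hz.le s.2
      have h3 := mul_le_mul_of_nonneg_right (h2.trans h1) (by positivity : 0 ≤ 2 / z₀.re)
      have h4 : (s : ℝ) * (z₀.re / 2) * (2 / z₀.re) = s := by field_simp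
      rwa [h4] at h3)
    (H.integrable.norm.mul_const _)
    (Eventually.of_forall fun s z _ => by
      have h1 : HasDerivAt (fun z : ℂ => -((s : ℝ) : ℂ) * z) (-((s : ℝ) : ℂ)) z := by
        simpa using (hasDerivAt_id z).const_mul (-((s : ℝ) : ℂ))
      exact h1.cexp.const_mul (h s))
  exact this.2.differentiableAt.differentiableWithinAt

/-! ### Convergence of the calculus under the shift -/

section Main

variable {X : Type*} [NormedAddCommGroup X] [NormedSpace ℂ X] [CompleteSpace X]

/-- The density `h` is the same for all `δ`; the shift only contributes the factor `e^{-δs} ≤ 1`,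
which makes dominated convergence applicable. -/
theorem hillePhillips_shift {c : ComplexMeasure ℝ≥0} {m : Measure ℝ≥0} {h : ℝ≥0 → ℂ}
    (H : HasDensity c m h id) (T : BoundedC0Semigroup X) (δ : ℝ≥0) (x : X) :
    hillePhillips (T.shift δ) c x =
      ∫ s, h s • ((Real.exp (-((δ : ℝ) * (s : ℝ))) : ℝ) : ℂ) • T.toFun s x ∂m :=
  H.hillePhillips_eq (T.shift δ) x

/-- Strong continuity of `δ ↦ e(A + δ)` at `0`, jointly with the argument. -/
theorem tendsto_hillePhillips_shift (T : BoundedC0Semigroup X) (c : ComplexMeasure ℝ≥0)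
    {y : ℝ≥0 → X} {y₀ : X} (hy : Tendsto y (𝓝[>] 0) (𝓝 y₀)) :
    Tendsto (fun δ => hillePhillips (T.shift δ) c (y δ)) (𝓝[>] 0)
      (𝓝 (hillePhillips T c y₀)) := by
  obtain ⟨h, H⟩ := exists_hasDensity_id c (le_refl c.variation)
  obtain ⟨M, hM0, hM⟩ := T.exists_norm_orbit_le
  have hexp : ∀ δ s : ℝ≥0, Real.exp (-((δ : ℝ) * (s : ℝ))) ≤ 1 := fun δ s =>
    Real.exp_le_one_iff.2 (neg_nonpos.2 (by positivity))
  simp only [hillePhillips_shift H, H.hillePhillips_eq T y₀]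
  refine tendsto_integral_filter_of_dominated_convergence (fun s => ‖h s‖ * (M * (‖y₀‖ + 1)))
    (Eventually.of_forall fun δ => ?_) ?_ (H.integrable.norm.mul_const _)
    (Eventually.of_forall fun s => ?_)
  · have h1 : Continuous fun s : ℝ≥0 =>
        ((Real.exp (-((δ : ℝ) * (s : ℝ))) : ℝ) : ℂ) • T.toFun s (y δ) := by
      have := T.continuous_orbit (y δ)
      fun_prop
    exact H.integrable.aestronglyMeasurable.smul h1.aestronglyMeasurable
  · have hy1 : ∀ᶠ δ in 𝓝[>] (0 : ℝ≥0), ‖y δ‖ ≤ ‖y₀‖ + 1 :=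
      hy.norm.eventually (Iic_mem_nhds (by linarith))
    filter_upwards [hy1] with δ hδ
    refine Eventually.of_forall fun s => ?_
    rw [norm_smul, norm_smul, Complex.norm_real, Real.norm_eq_abs, abs_of_pos (Real.exp_pos _)]
    refine mul_le_mul_of_nonneg_left ?_ (norm_nonneg _)
    refine (mul_le_of_le_one_left (norm_nonneg _) (hexp δ s)).trans ((hM s _).trans ?_)
    exact mul_le_mul_of_nonneg_left hδ hM0
  · have h1 : Tendsto (fun δ : ℝ≥0 => ((Real.exp (-((δ : ℝ) * (s : ℝ))) : ℝ) : ℂ)) (𝓝[>] 0)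
        (𝓝 1) := by
      have hc : Continuous fun δ : ℝ≥0 => ((Real.exp (-((δ : ℝ) * (s : ℝ))) : ℝ) : ℂ) := by
        fun_prop
      exact (hc.tendsto' 0 1 (by simp)).mono_left nhdsWithin_le_nhds
    have h2 := (h1.smul (((T.toFun s).continuous.tendsto y₀).comp hy)).const_smul (h s)
    simpa using h2

/-- `(1 + A)² x` for `x ∈ dom(A²)`, and the recovery of `x` from it. -/
theorem resolventIntegral_sq_shift {T : BoundedC0Semigroup X} {A : X →ₗ.[ℂ] X}
    (hA : IsGenerator T (-A)) {x : X} (hx : x ∈ A.domain) (hx2 : A ⟨x, hx⟩ ∈ A.domain) (δ : ℝ≥0) :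
    resolventIntegral (T.shift δ) (resolventIntegral (T.shift δ)
      ((1 + ((δ : ℝ) : ℂ)) ^ 2 • x + (2 * (1 + ((δ : ℝ) : ℂ))) • A ⟨x, hx⟩ +
        A ⟨A ⟨x, hx⟩, hx2⟩)) = x := by
  have hB := hA.shift δ
  set d : ℂ := ((δ : ℝ) : ℂ) with hd
  have happ : ∀ u : (addScalar A δ).domain, (addScalar A δ) u = d • (u : X) + A ⟨u, u.2⟩ :=
    fun u => rfl
  -- `u = (1 + δ + A) x`; the vector in the statement is `(1 + δ + A) u`, so the resolvent identity
  -- is used twice.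
  set u : X := (1 + d) • x + A ⟨x, hx⟩ with hu
  have humem : u ∈ A.domain := A.domain.add_mem (A.domain.smul_mem _ hx) hx2
  have hAu : A ⟨u, humem⟩ = (1 + d) • A ⟨x, hx⟩ + A ⟨A ⟨x, hx⟩, hx2⟩ := by
    have : (⟨u, humem⟩ : A.domain) = (1 + d) • ⟨x, hx⟩ + ⟨A ⟨x, hx⟩, hx2⟩ := rfl
    rw [this, LinearPMap.map_add, LinearPMap.map_smul]
  have e1 := hB.resolventIntegral_add ⟨u, humem⟩
  have e2 := hB.resolventIntegral_add ⟨x, hx⟩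
  rw [happ] at e1 e2
  simp only [hAu] at e1
  have e3 : x + (d • x + A ⟨x, hx⟩) = u := by rw [hu]; module
  have e4 : (1 + d) ^ 2 • x + (2 * (1 + d)) • A ⟨x, hx⟩ + A ⟨A ⟨x, hx⟩, hx2⟩ =
      u + (d • u + ((1 + d) • A ⟨x, hx⟩ + A ⟨A ⟨x, hx⟩, hx2⟩)) := by rw [hu]; module
  rw [e4, e1, ← e3, e2]

/-- Convergence on `dom(A²)` when `(1 + z)⁻² g` is a Laplace transform. -/
theorem tendsto_extHP_shift {A : X →ₗ.[ℂ] X} {T : BoundedC0Semigroup X}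
    (hA : IsGenerator T (-A)) {g : ℂ → ℂ}
    (hν : IsLaplaceTransform fun z => (1 + z)⁻¹ * (1 + z)⁻¹ * g z) :
    ∃ (h₀ : IsRegularizable T g) (h : ∀ δ : ℝ≥0, IsRegularizable (T.shift δ) g),
      ∀ x ∈ domSq A,
        ∃ (hx₀ : x ∈ (extHP T g h₀).domain)
          (hx : ∀ δ : ℝ≥0, x ∈ (extHP (T.shift δ) g (h δ)).domain),
          Tendsto (fun δ : ℝ≥0 => extHP (T.shift δ) g (h δ) ⟨x, hx δ⟩) (𝓝[>] 0)
            (𝓝 (extHP T g h₀ ⟨x, hx₀⟩)) := by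
  -- `g` is `(1 + z)²` times a Laplace transform, hence holomorphic.
  have hdiff : DifferentiableOn ℂ g {z | 0 < z.re} := by
    have h1 : DifferentiableOn ℂ (fun z : ℂ => (1 + z) * (1 + z)) {z | 0 < z.re} := by fun_prop
    refine (h1.mul hν.differentiableOn).congr fun z hz => ?_
    have hz : 0 < z.re := hz
    have hne : 1 + z ≠ 0 := fun h => by
      have := congrArg Complex.re h
      simp at this
      linarith
    simp only [Pi.mul_apply]
    field_simp
  obtain ⟨ν, hν⟩ := hν
  obtain ⟨μ, hμ, hJ⟩ := exists_laplace_eq_inv_sq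
  have hL : ∀ z : ℂ, 0 < z.re → laplace ν z = laplace μ z * g z := fun z hz => by
    rw [hν z hz, hμ z hz]
  have hinj : ∀ T : BoundedC0Semigroup X, Function.Injective (hillePhillips T μ) := by
    intro T
    refine (injective_iff_map_eq_zero _).2 fun x hx => ?_
    rw [hJ] at hx
    exact resolventIntegral_eq_zero (resolventIntegral_eq_zero hx)
  -- The same pair `μ`, `ν` serves every semigroup, so it does not vary with `δ`.
  have hreg : ∀ T : BoundedC0Semigroup X, IsRegularizable T g := fun T =>
    ⟨hdiff, ⟨⟨μ, ν, hL, hinj T⟩⟩⟩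
  refine ⟨hreg T, fun δ => hreg _, ?_⟩
  rintro x ⟨hx, hx2⟩
  set y : ℝ≥0 → X := fun δ => (1 + ((δ : ℝ) : ℂ)) ^ 2 • x + (2 * (1 + ((δ : ℝ) : ℂ))) • A ⟨x, hx⟩ +
        A ⟨A ⟨x, hx⟩, hx2⟩ with hy
  have hyx : ∀ δ, hillePhillips (T.shift δ) μ (y δ) = x := fun δ => by
    rw [hJ]; exact resolventIntegral_sq_shift hA hx hx2 δ
  have hT0 : T.shift 0 = T := by
    obtain ⟨t, _, _, _, _⟩ := T
    simp [BoundedC0Semigroup.shift]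
  have hyx0 : hillePhillips T μ (y 0) = x := by
    have := hyx 0
    rwa [hT0] at this
  have hcont : Continuous y := by fun_prop
  -- `extHP` uses an unspecified regularizer; its values on `dom(A²)` are nevertheless computed with
  -- `μ` and `ν`.
  have key : ∀ δ, ∃ h : x ∈ (extHP (T.shift δ) g (hreg _)).domain,
      extHP (T.shift δ) g (hreg _) ⟨x, h⟩ = hillePhillips (T.shift δ) ν (y δ) := fun δ =>
    Regularizer.op_apply_of_mem_range _ hL (hyx δ)
  obtain ⟨h0, e0⟩ : ∃ h : x ∈ (extHP T g (hreg _)).domain,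
      extHP T g (hreg _) ⟨x, h⟩ = hillePhillips T ν (y 0) :=
    Regularizer.op_apply_of_mem_range _ hL hyx0
  refine ⟨h0, fun δ => (key δ).1, ?_⟩
  rw [e0]
  refine (tendsto_hillePhillips_shift T ν
    ((hcont.tendsto 0).mono_left nhdsWithin_le_nhds)).congr fun δ => ?_
  exact (key δ).2.symm

end Main

/-- `1 + wt` is a convex combination of `1` and `1 + w`. -/
theorem re_one_add_mul_pos {w : ℂ} (hw : 0 < (1 + w).re) {t : ℝ} (ht : t ∈ Set.Icc (0 : ℝ) 1) :
    0 < (1 + w * (t : ℂ)).re := by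
  have h1 : (1 + w * (t : ℂ)).re = (1 - t) + t * (1 + w).re := by
    simp
    ring
  rw [h1]
  rcases ht.1.eq_or_lt with h0 | h0
  · rw [← h0]; norm_num
  · linarith [mul_pos h0 hw, ht.2]

/-! ### Spectral measures and the Schur complement -/

section SpectralMeasure

variable {H : Type*} [NormedAddCommGroup H] [InnerProductSpace ℂ H] [CompleteSpace H]

theorem isSelfAdjoint_cfcHom_real {S : H →L[ℂ] H} (hS : IsSelfAdjoint S)
    (F : C(spectrum ℝ S, ℝ)) : IsSelfAdjoint (cfcHom hS F) := by
  rw [IsSelfAdjoint, ← map_star]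
  congr 1

/-- The spectral measure of a self-adjoint operator at a vector. -/
theorem exists_spectralMeasure {S : H →L[ℂ] H} (hS : IsSelfAdjoint S) (v : H) :
    ∃ σ : Measure (spectrum ℝ S), IsFiniteMeasure σ ∧ ∀ F : C(spectrum ℝ S, ℝ),
      inner ℂ v (cfcHom hS F v) = ((∫ t, F t ∂σ : ℝ) : ℂ) := by
  have hcpt : CompactSpace (spectrum ℝ S) := isCompact_iff_compactSpace.1 (spectrum.isCompact S)
  let l : CompactlySupportedContinuousMap (spectrum ℝ S) ℝ →ₗ[ℝ] ℝ :=
    { toFun := fun F => RCLike.re (inner ℂ v (cfcHom hS F.toContinuousMap v))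
      map_add' := fun F G => by
        have : (F + G).toContinuousMap = F.toContinuousMap + G.toContinuousMap := rfl
        rw [this, map_add, add_apply, inner_add_right, map_add]
      map_smul' := fun r F => by
        have : (r • F).toContinuousMap = r • F.toContinuousMap := rfl
        rw [this, map_smul, smul_apply, inner_smul_right_eq_smul, RCLike.smul_re]
        rfl }
  have hpos : ∀ F : CompactlySupportedContinuousMap (spectrum ℝ S) ℝ, 0 ≤ F → 0 ≤ l F := by
    intro F hF
    -- With `F = G²`, the form at `v` is `‖G(S) v‖²`, so it is nonnegative and Riesz-Markov applies.
    let G : C(spectrum ℝ S, ℝ) := ⟨fun t => Real.sqrt (F t), by fun_prop⟩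
    have hG : F.toContinuousMap = G * G := by
      ext t
      exact (Real.mul_self_sqrt (hF t)).symm
    change 0 ≤ RCLike.re (inner ℂ v (cfcHom hS F.toContinuousMap v))
    rw [hG, map_mul, mul_apply_eq_comp, ← ContinuousLinearMap.adjoint_inner_left,
      ← ContinuousLinearMap.star_eq_adjoint, (isSelfAdjoint_cfcHom_real hS G).star_eq]
    exact inner_self_nonneg
  refine ⟨RealRMK.rieszMeasure (PositiveLinearMap.mk₀ l hpos), inferInstance, fun F => ?_⟩
  have h1 := RealRMK.integral_rieszMeasure (PositiveLinearMap.mk₀ l hpos)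
    (CompactlySupportedContinuousMap.continuousMapEquiv F)
  have h2 : ∫ t, F t ∂(RealRMK.rieszMeasure (PositiveLinearMap.mk₀ l hpos)) =
    RCLike.re (inner ℂ v (cfcHom hS F v)) := h1
  rw [h2]
  have h3 : (starRingEnd ℂ) (inner ℂ v (cfcHom hS F v)) = inner ℂ v (cfcHom hS F v) := by
    rw [inner_conj_symm]
    conv_lhs => rw [← (isSelfAdjoint_cfcHom_real hS F).star_eq,
      ContinuousLinearMap.star_eq_adjoint, ContinuousLinearMap.adjoint_inner_left]
  exact (Complex.conj_eq_iff_re.1 h3).symm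

/-- The resolvent of a self-adjoint operator through its spectral measure. -/
theorem exists_resolvent_spectralMeasure {S : H →L[ℂ] H} (hS : IsSelfAdjoint S) (v : H) :
    ∃ σ : Measure (spectrum ℝ S), IsFiniteMeasure σ ∧ ∀ w : ℂ,
      (∀ t ∈ spectrum ℝ S, 1 + w * ((t : ℝ) : ℂ) ≠ 0) →
      ∃ x : H, x + w • S x = v ∧
        inner ℂ v x = ∫ t : spectrum ℝ S, (1 + w * ((t : ℝ) : ℂ))⁻¹ ∂σ := by
  have hcpt : CompactSpace (spectrum ℝ S) := isCompact_iff_compactSpace.1 (spectrum.isCompact S)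
  obtain ⟨σ, hσ, hF⟩ := exists_spectralMeasure hS v
  refine ⟨σ, hσ, fun w hw => ?_⟩
  have hinv : Continuous fun t : spectrum ℝ S => (1 + w * (((t : ℝ) : ℂ)))⁻¹ :=
    Continuous.inv₀ (by fun_prop) fun t => hw t t.2
  -- The calculus is real, so `(1 + wt)⁻¹` is split as `a + ib`; `e1` and `e2` are the real and
  -- imaginary parts of `(1 + wt)(a + ib) = 1`.
  let a : C(spectrum ℝ S, ℝ) := ⟨fun t => ((1 + w * ((t : ℝ) : ℂ))⁻¹).re, Complex.continuous_re.comp hinv⟩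
  let b : C(spectrum ℝ S, ℝ) := ⟨fun t => ((1 + w * ((t : ℝ) : ℂ))⁻¹).im, Complex.continuous_im.comp hinv⟩
  let ι : C(spectrum ℝ S, ℝ) := ContinuousMap.restrict (spectrum ℝ S) (ContinuousMap.id ℝ)
  have hι : cfcHom hS ι = S := cfcHom_id hS
  have hmul : ∀ t : spectrum ℝ S, (1 + w * ((t : ℝ) : ℂ)) * (1 + w * ((t : ℝ) : ℂ))⁻¹ = 1 :=
    fun t => mul_inv_cancel₀ (hw t t.2)
  have e1 : a + w.re • (ι * a) - w.im • (ι * b) = 1 := by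
    ext t
    have := congrArg Complex.re (hmul t)
    simp only [Complex.mul_re, Complex.add_re, Complex.add_im, Complex.one_re, Complex.one_im,
      Complex.mul_im, Complex.ofReal_re, Complex.ofReal_im] at this
    change ((1 + w * ((t : ℝ) : ℂ))⁻¹).re + w.re * ((t : ℝ) * ((1 + w * ((t : ℝ) : ℂ))⁻¹).re) -
      w.im * ((t : ℝ) * ((1 + w * ((t : ℝ) : ℂ))⁻¹).im) = 1
    linarith
  have e2 : b + w.re • (ι * b) + w.im • (ι * a) = 0 := by
    ext t
    have := congrArg Complex.im (hmul t)
    simp only [Complex.mul_re, Complex.add_re, Complex.add_im, Complex.one_re, Complex.one_im,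
      Complex.mul_im, Complex.ofReal_re, Complex.ofReal_im] at this
    change ((1 + w * ((t : ℝ) : ℂ))⁻¹).im + w.re * ((t : ℝ) * ((1 + w * ((t : ℝ) : ℂ))⁻¹).im) +
      w.im * ((t : ℝ) * ((1 + w * ((t : ℝ) : ℂ))⁻¹).re) = 0
    linarith
  have f1 := congrArg (fun F => cfcHom hS F v) e1
  have f2 := congrArg (fun F => cfcHom hS F v) e2
  simp only [map_add, map_sub, map_smul, map_mul, hι, map_one, map_zero, add_apply, sub_apply,
    smul_apply, mul_apply_eq_comp, one_apply_eq_self,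
    zero_apply] at f1 f2
  refine ⟨cfcHom hS a v + Complex.I • cfcHom hS b v, ?_, ?_⟩
  · rw [map_add, map_smul]
    have hw' : w = (w.re : ℂ) + (w.im : ℂ) * Complex.I := (Complex.re_add_im w).symm
    rw [hw']
    have : (cfcHom hS a v + Complex.I • cfcHom hS b v) + ((w.re : ℂ) + (w.im : ℂ) * Complex.I) •
        (S (cfcHom hS a v) + Complex.I • S (cfcHom hS b v)) =
        (cfcHom hS a v + (w.re : ℂ) • S (cfcHom hS a v) +
          (Complex.I * Complex.I) • (w.im : ℂ) • S (cfcHom hS b v)) +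
        Complex.I • (cfcHom hS b v + (w.re : ℂ) • S (cfcHom hS b v) +
          (w.im : ℂ) • S (cfcHom hS a v)) := by
      module
    rw [this, Complex.I_mul_I]
    simp only [Complex.coe_smul, neg_one_smul, ← sub_eq_add_neg]
    rw [f1, f2, smul_zero, add_zero]
  · have hint : Integrable (fun t : spectrum ℝ S => (1 + w * (((t : ℝ) : ℂ)))⁻¹) σ :=
      hinv.integrable_of_hasCompactSupport (HasCompactSupport.of_compactSpace _)
    rw [inner_add_right, inner_smul_right, hF, hF]
    have := integral_re_add_im hint
    rw [← this, mul_comm]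
    rfl

/-- A Schur complement computation: the compression of `(1 + wΘ)⁻¹` to a vector. -/
theorem exists_schur_complement {Θ : H →L[ℂ] H} (hΘ : 0 ≤ Θ) (hΘ1 : ‖Θ‖ ≤ 1) (u : H) :
    ∃ (c : ℝ) (σ : Measure ℝ), IsFiniteMeasure σ ∧ (∀ᵐ t ∂σ, t ∈ Set.Icc (0 : ℝ) 1) ∧
      ∀ w : ℂ, 0 < (1 + w).re → ∃ (y : H) (l : ℂ), inner ℂ u y = 0 ∧
        (u - y) + w • Θ (u - y) = l • u ∧
        l * inner ℂ u u = inner ℂ u u + w * c - w ^ 2 * ∫ t : ℝ, (1 + w * (t : ℂ))⁻¹ ∂σ := by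
  -- The aim is `y ⊥ u` with `(1 + wΘ)(u - y)` in the span of `u`. Applying `Q` turns this into `(1
  -- + wS) y = w v` with `v = QΘu`, so `y = w (1 + wS)⁻¹ v`. Pairing with `u` then gives the
  -- formula, with `c = ⟨u, Θu⟩` and `σ` the spectral measure of `S` at `v`.
  set Q := (ℂ ∙ u)ᗮ.starProjection with hQ
  set S : H →L[ℂ] H := Q ∘L Θ ∘L Q with hSdef
  have hΘp : Θ.IsPositive := (ContinuousLinearMap.nonneg_iff_isPositive Θ).1 hΘ
  have hSpos : S.IsPositive := hΘp.conj_starProjection _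
  have hS : IsSelfAdjoint S := hSpos.isSelfAdjoint
  have hQ1 : ‖Q‖ ≤ 1 := Submodule.starProjection_norm_le _
  have hS1 : ‖S‖ ≤ 1 := by
    have h1 := ContinuousLinearMap.opNorm_comp_le Q (Θ ∘L Q)
    have h2 := ContinuousLinearMap.opNorm_comp_le Θ Q
    have h3 : ‖Θ‖ * ‖Q‖ ≤ 1 := mul_le_one₀ hΘ1 (norm_nonneg _) hQ1
    exact h1.trans (mul_le_one₀ hQ1 (norm_nonneg _) (h2.trans h3))
  have hspec : ∀ t ∈ spectrum ℝ S, t ∈ Set.Icc (0 : ℝ) 1 := by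
    intro t ht
    refine ⟨spectrum_nonneg_of_nonneg ((ContinuousLinearMap.nonneg_iff_isPositive S).2 hSpos) ht,
      ?_⟩
    -- Bounding the spectrum by the norm needs `‖1‖ = 1`; on the zero space the spectrum is empty.
    have hnt : Nontrivial H := by
      by_contra hn
      rw [not_nontrivial_iff_subsingleton] at hn
      have : Subsingleton (H →L[ℂ] H) := inferInstance
      simp [spectrum.of_subsingleton] at ht
    exact (le_abs_self t).trans ((spectrum.norm_le_norm_of_mem ht).trans hS1)
  set v := Q (Θ u) with hv
  obtain ⟨σ, hσ, hR⟩ := exists_resolvent_spectralMeasure hS v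
  have hQQ : ∀ x, Q (Q x) = Q x := fun x => by
    have := congrArg (fun T => T x) (Submodule.isIdempotentElem_starProjection (ℂ ∙ u)ᗮ).eq
    rwa [mul_apply_eq_comp] at this
  have hQu : Q u = 0 := by
    rw [hQ, Submodule.starProjection_apply_eq_zero_iff, Submodule.orthogonal_orthogonal]
    exact Submodule.mem_span_singleton_self u
  refine ⟨(inner ℂ u (Θ u)).re, σ.map Subtype.val, inferInstance, ?_, fun w hw => ?_⟩
  · refine (ae_map_iff measurable_subtype_coe.aemeasurable measurableSet_Icc).2 ?_
    exact Eventually.of_forall fun t => hspec t t.2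
  · obtain ⟨x, hx1, hx2⟩ := hR w (fun t ht h => by
      have := re_one_add_mul_pos hw (hspec t ht)
      rw [h, Complex.zero_re] at this
      exact this.false)
    have hy : Q (w • x) = w • x := by
      have hx : x = v - w • S x := by rw [← hx1]; abel
      have : Q x = x := by
        rw [hx, map_sub, map_smul]
        simp only [hSdef, ContinuousLinearMap.comp_apply, hv, hQQ]
      rw [map_smul, this]
    have huy : inner ℂ u (w • x) = 0 := by
      rw [← hy, hQ, ← Submodule.inner_starProjection_left_eq_right, ← hQ, hQu, inner_zero_left]
    have hker : Q ((u - w • x) + w • Θ (u - w • x)) = 0 := by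
      have hS' : S (w • x) = Q (Θ (w • x)) := by
        simp only [hSdef, ContinuousLinearMap.comp_apply, hy]
      have : Q ((u - w • x) + w • Θ (u - w • x)) = w • (v - (x + w • S x)) := by
        simp only [map_add, map_sub, hy, hQu, map_smul, smul_sub, ← hv]
        rw [map_smul, map_smul, map_smul] at hS'
        have h5 : w • w • Q (Θ x) = w • w • S x := by rw [hS']
        rw [smul_add, h5]
        abel
      rw [this, hx1, sub_self, smul_zero]
    rw [hQ, Submodule.starProjection_apply_eq_zero_iff, Submodule.orthogonal_orthogonal,
      Submodule.mem_span_singleton] at hker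
    obtain ⟨l, hl⟩ := hker
    refine ⟨w • x, l, huy, hl.symm, ?_⟩
    have hint : ∫ t, (1 + w * ((t : ℝ) : ℂ))⁻¹ ∂(σ.map Subtype.val) =
        ∫ t : spectrum ℝ S, (1 + w * ((t : ℝ) : ℂ))⁻¹ ∂σ :=
      (MeasurableEmbedding.subtype_coe (spectrum.isCompact S).measurableSet).integral_map _
    rw [hint, ← hx2, ← inner_smul_right, hl, inner_add_right, inner_sub_right, huy, sub_zero,
      inner_smul_right, map_sub, inner_sub_right]
    have hc : inner ℂ u (Θ u) = (((inner ℂ u (Θ u)).re : ℝ) : ℂ) := by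
      have := hΘp.isSelfAdjoint
      have h3 : (starRingEnd ℂ) (inner ℂ u (Θ u)) = inner ℂ u (Θ u) := by
        rw [inner_conj_symm]
        conv_lhs => rw [← this.star_eq,
          ContinuousLinearMap.star_eq_adjoint, ContinuousLinearMap.adjoint_inner_left]
      exact (Complex.conj_eq_iff_re.1 h3).symm
    have hΘy : inner ℂ u (Θ (w • x)) = w * inner ℂ v x := by
      rw [← ContinuousLinearMap.adjoint_inner_left, ← ContinuousLinearMap.star_eq_adjoint,
        hΘp.isSelfAdjoint.star_eq, ← hy, hQ, ← Submodule.inner_starProjection_left_eq_right,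
        inner_smul_right]
    rw [hΘy, ← hc]
    ring

end SpectralMeasure

/-! ### Multiplication by the coordinate on L² -/

section Multiplication

/-- The truncation of the identity of `ℝ` to `[0, 1]`. -/
noncomputable def unitClamp (t : ℝ) : ℝ := max 0 (min t 1)

theorem unitClamp_mem (t : ℝ) : unitClamp t ∈ Set.Icc (0 : ℝ) 1 :=
  ⟨le_max_left _ _, max_le zero_le_one (min_le_right _ _)⟩

theorem unitClamp_of_mem {t : ℝ} (ht : t ∈ Set.Icc (0 : ℝ) 1) : unitClamp t = t := by
  rw [unitClamp, min_eq_left ht.2, max_eq_right ht.1]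

theorem continuous_unitClamp : Continuous unitClamp := by
  unfold unitClamp; fun_prop

theorem norm_unitClamp_mul_le (t : ℝ) (z : ℂ) : ‖(unitClamp t : ℂ) * z‖ ≤ ‖z‖ := by
  rw [norm_mul, Complex.norm_real, Real.norm_eq_abs, abs_of_nonneg (unitClamp_mem t).1]
  exact mul_le_of_le_one_left (norm_nonneg _) (unitClamp_mem t).2

/-- Clamping bounds the multiplier by `1` everywhere, so the operator exists for every `ρ`; where `t
∈ [0, 1]` it is multiplication by `t`. -/
theorem memLp_unitClamp_mul {ρ : Measure ℝ} (f : Lp ℂ 2 ρ) :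
    MemLp (fun t => (unitClamp t : ℂ) * f t) 2 ρ := by
  have hc : Continuous fun t => (unitClamp t : ℂ) :=
    Complex.continuous_ofReal.comp continuous_unitClamp
  exact (Lp.memLp f).of_le (hc.aestronglyMeasurable.mul (Lp.memLp f).1)
    (Eventually.of_forall fun t => norm_unitClamp_mul_le t _)

/-- Multiplication by the coordinate on `L²(ρ)`, for `ρ` concentrated on `[0, 1]`. -/
noncomputable def mulClamp (ρ : Measure ℝ) : Lp ℂ 2 ρ →L[ℂ] Lp ℂ 2 ρ :=
  LinearMap.mkContinuous
    { toFun := fun f => (memLp_unitClamp_mul f).toLp _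
      map_add' := fun f g => by
        refine Lp.ext ?_
        filter_upwards [(memLp_unitClamp_mul (f + g)).coeFn_toLp,
          (memLp_unitClamp_mul f).coeFn_toLp, (memLp_unitClamp_mul g).coeFn_toLp,
          Lp.coeFn_add f g, Lp.coeFn_add ((memLp_unitClamp_mul f).toLp _)
            ((memLp_unitClamp_mul g).toLp _)] with t h1 h2 h3 h4 h5
        rw [h1, h5, Pi.add_apply, h2, h3, h4, Pi.add_apply, mul_add]
      map_smul' := fun c f => by
        refine Lp.ext ?_
        filter_upwards [(memLp_unitClamp_mul (c • f)).coeFn_toLp,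
          (memLp_unitClamp_mul f).coeFn_toLp, Lp.coeFn_smul c f,
          Lp.coeFn_smul c ((memLp_unitClamp_mul f).toLp _)] with t h1 h2 h3 h4
        rw [RingHom.id_apply, h1, h4, Pi.smul_apply, h2, h3, Pi.smul_apply, smul_eq_mul,
          smul_eq_mul]
        ring }
    1 fun f => by
      rw [one_mul]
      refine Lp.norm_le_norm_of_ae_le ?_
      filter_upwards [(memLp_unitClamp_mul f).coeFn_toLp] with t ht
      change ‖((memLp_unitClamp_mul f).toLp _ : Lp ℂ 2 ρ) t‖ ≤ _
      rw [ht]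
      exact norm_unitClamp_mul_le t _

theorem coeFn_mulClamp (ρ : Measure ℝ) (f : Lp ℂ 2 ρ) :
    mulClamp ρ f =ᵐ[ρ] fun t => (unitClamp t : ℂ) * f t :=
  (memLp_unitClamp_mul f).coeFn_toLp

theorem norm_mulClamp_le (ρ : Measure ℝ) : ‖mulClamp ρ‖ ≤ 1 :=
  LinearMap.mkContinuous_norm_le _ zero_le_one _

theorem mulClamp_nonneg (ρ : Measure ℝ) : 0 ≤ mulClamp ρ := by
  rw [ContinuousLinearMap.nonneg_iff_isPositive, ContinuousLinearMap.isPositive_def]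
  refine ⟨fun f g => ?_, fun f => ?_⟩
  · change inner ℂ (mulClamp ρ f) g = inner ℂ f (mulClamp ρ g)
    rw [L2.inner_def, L2.inner_def]
    refine integral_congr_ae ?_
    filter_upwards [coeFn_mulClamp ρ f, coeFn_mulClamp ρ g] with t h1 h2
    rw [h1, h2]
    simp only [RCLike.inner_apply, map_mul, Complex.conj_ofReal]
    ring
  · rw [ContinuousLinearMap.reApplyInnerSelf_apply, L2.inner_def]
    have : ∫ t, inner ℂ (mulClamp ρ f t) (f t) ∂ρ =
        ((∫ t, unitClamp t * ‖f t‖ ^ 2 ∂ρ : ℝ) : ℂ) := by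
      rw [← integral_complex_ofReal]
      refine integral_congr_ae ?_
      filter_upwards [coeFn_mulClamp ρ f] with t h1
      rw [h1]
      simp only [RCLike.inner_apply, map_mul, Complex.conj_ofReal]
      rw [mul_left_comm, Complex.mul_conj']
      push_cast
      ring
    rw [this]
    simp only [RCLike.re_to_complex, Complex.ofReal_re]
    exact integral_nonneg fun t => mul_nonneg (unitClamp_mem t).1 (by positivity)

/-- The reciprocal of the transform `w ↦ ∫ (1 + wt)⁻¹ ρ(dt)` of a measure on `[0, 1]`. -/
theorem exists_reciprocal_transform (ρ : Measure ℝ) [IsFiniteMeasure ρ]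
    (hρ : ∀ᵐ t ∂ρ, t ∈ Set.Icc (0 : ℝ) 1) :
    ∃ (c : ℝ) (σ : Measure ℝ), IsFiniteMeasure σ ∧ (∀ᵐ t ∂σ, t ∈ Set.Icc (0 : ℝ) 1) ∧
      ∀ w : ℂ, 0 < (1 + w).re →
        (∫ t : ℝ, (1 + w * (t : ℂ))⁻¹ ∂ρ) *
          ((ρ.real Set.univ : ℂ) + w * c - w ^ 2 * ∫ t : ℝ, (1 + w * (t : ℂ))⁻¹ ∂σ) =
        (ρ.real Set.univ : ℂ) ^ 2 := by
  set u : Lp ℂ 2 ρ := Lp.const 2 ρ (1 : ℂ) with hu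
  have hu1 : u =ᵐ[ρ] fun _ => (1 : ℂ) := Lp.coeFn_const ..
  obtain ⟨c, σ, hσ, hσ1, h⟩ := exists_schur_complement (mulClamp_nonneg ρ) (norm_mulClamp_le ρ) u
  refine ⟨c, σ, hσ, hσ1, fun w hw => ?_⟩
  obtain ⟨y, l, hy, hl, hlu⟩ := h w hw
  have huf : ∀ f : Lp ℂ 2 ρ, inner ℂ u f = ∫ t, f t ∂ρ := by
    intro f
    rw [L2.inner_def]
    refine integral_congr_ae ?_
    filter_upwards [hu1] with t ht
    rw [ht]
    simp [RCLike.inner_apply]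
  have huu : inner ℂ u u = (ρ.real Set.univ : ℂ) := by
    rw [huf, integral_congr_ae hu1]
    simp
  -- Since `(1 + wΘ)(u - y) = l u`, the function `u - y` is `l (1 + wt)⁻¹`. As `y ⊥ u`, the left
  -- side is the mass of `ρ`; multiplying by the formula for `l ⟨u, u⟩` cancels `l`.
  have hx : inner ℂ u (u - y) = l * ∫ t : ℝ, (1 + w * (t : ℂ))⁻¹ ∂ρ := by
    rw [huf, ← integral_const_mul]
    refine integral_congr_ae ?_
    have hl' : ((u - y) + w • mulClamp ρ (u - y) : Lp ℂ 2 ρ) =ᵐ[ρ] (l • u : Lp ℂ 2 ρ) := by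
      rw [hl]
    filter_upwards [hl', hρ, hu1, coeFn_mulClamp ρ (u - y), Lp.coeFn_smul l u,
      Lp.coeFn_smul w (mulClamp ρ (u - y)),
      Lp.coeFn_add (u - y) (w • mulClamp ρ (u - y))] with t h1 h2 h3 h4 h5 h6 h7
    rw [h7, h5, Pi.add_apply, h6, Pi.smul_apply, Pi.smul_apply, h3, h4, unitClamp_of_mem h2,
      smul_eq_mul, smul_eq_mul, mul_one] at h1
    have hne : 1 + w * (t : ℂ) ≠ 0 := fun h => by
      have := re_one_add_mul_pos hw h2
      rw [h, Complex.zero_re] at this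
      exact this.false
    rw [eq_mul_inv_iff_mul_eq₀ hne, ← h1]
    ring
  rw [inner_sub_right, hy, sub_zero, huu] at hx
  rw [huu] at hlu
  rw [← hlu, sq]
  nth_rewrite 3 [hx]
  ring

end Multiplication

/-! ### The reciprocal as a Laplace transform -/

section Reciprocal

theorem norm_inv_one_add_mul_le {w : ℂ} (hw : 0 < (1 + w).re) {t : ℝ}
    (ht : t ∈ Set.Icc (0 : ℝ) 1) : ‖(1 + w * (t : ℂ))⁻¹‖ ≤ (min 1 (1 + w).re)⁻¹ := by
  rw [norm_inv]
  have h0 : 0 < min 1 (1 + w).re := lt_min one_pos hw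
  refine inv_anti₀ h0 (le_trans ?_ ((le_abs_self _).trans (Complex.abs_re_le_norm _)))
  have h1 : (1 + w * (t : ℂ)).re = (1 - t) + t * (1 + w).re := by
    simp
    ring
  rw [h1]
  nlinarith [min_le_left 1 (1 + w).re, min_le_right 1 (1 + w).re, ht.1, ht.2,
    mul_le_mul_of_nonneg_left (min_le_right 1 (1 + w).re) ht.1,
    mul_le_mul_of_nonneg_left (min_le_left 1 (1 + w).re) (sub_nonneg.2 ht.2)]

theorem integrable_inv_one_add_mul {ρ : Measure ℝ} [IsFiniteMeasure ρ]
    (hρ : ∀ᵐ t ∂ρ, t ∈ Set.Icc (0 : ℝ) 1) {w : ℂ} (hw : 0 < (1 + w).re) :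
    Integrable (fun t : ℝ => (1 + w * (t : ℂ))⁻¹) ρ := by
  have hm : Measurable fun t : ℝ => (1 + w * (t : ℂ))⁻¹ := by fun_prop
  refine Integrable.of_bound hm.aestronglyMeasurable (min 1 (1 + w).re)⁻¹ ?_
  filter_upwards [hρ] with t ht
  exact norm_inv_one_add_mul_le hw ht

/-- Monotone convergence for `∫ (φ + ε)⁻¹` as `ε → 0`. -/
theorem integrable_inv_of_integral_inv_add_le {σ : Measure ℝ} [IsFiniteMeasure σ] {φ : ℝ → ℝ}
    (hφ : Measurable φ) (h0 : ∀ᵐ t ∂σ, 0 ≤ φ t) {C : ℝ}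
    (hC : ∀ ε : ℝ, 0 < ε → ε ≤ 1 / 2 → ∫ t, (φ t + ε)⁻¹ ∂σ ≤ C) :
    (∀ᵐ t ∂σ, 0 < φ t) ∧ Integrable (fun t => (φ t)⁻¹) σ := by
  -- The sequence starts at `1/2`, the largest value that `hC` admits.
  set ε : ℕ → ℝ := fun n => 1 / ((n : ℝ) + 1 + 1) with hε
  have hε0 : ∀ n, 0 < ε n := fun n => by positivity
  have hε1 : ∀ n, ε n ≤ 1 / 2 := fun n => by
    simp only [hε]
    refine one_div_le_one_div_of_le two_pos ?_
    have : (0 : ℝ) ≤ n := n.cast_nonneg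
    linarith
  have hεt : Tendsto ε atTop (𝓝 0) := by
    have := (tendsto_one_div_add_atTop_nhds_zero_nat (𝕜 := ℝ)).comp (tendsto_add_atTop_nat 1)
    refine this.congr fun n => ?_
    simp [hε]
  have hbound : ∀ n, ∫⁻ t, (ENNReal.ofReal (φ t + ε n))⁻¹ ∂σ ≤ ENNReal.ofReal C := by
    intro n
    have hint : Integrable (fun t => (φ t + ε n)⁻¹) σ := by
      refine Integrable.of_bound (by fun_prop) (ε n)⁻¹ ?_
      filter_upwards [h0] with t ht
      rw [Real.norm_eq_abs, abs_of_pos (inv_pos.2 (by linarith [hε0 n]))]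
      exact inv_anti₀ (hε0 n) (by linarith)
    have h1 : ∫⁻ t, (ENNReal.ofReal (φ t + ε n))⁻¹ ∂σ =
        ∫⁻ t, ENNReal.ofReal (φ t + ε n)⁻¹ ∂σ := by
      refine lintegral_congr_ae ?_
      filter_upwards [h0] with t ht
      rw [ENNReal.ofReal_inv_of_pos (by linarith [hε0 n])]
    rw [h1, ← ofReal_integral_eq_lintegral_ofReal hint]
    · exact ENNReal.ofReal_le_ofReal (hC _ (hε0 n) (hε1 n))
    · filter_upwards [h0] with t ht
      exact inv_nonneg.2 (by linarith [hε0 n])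
  have hfatou : ∫⁻ t, (ENNReal.ofReal (φ t))⁻¹ ∂σ ≤ ENNReal.ofReal C := by
    have h1 : ∀ t, (ENNReal.ofReal (φ t))⁻¹ =
        liminf (fun n => (ENNReal.ofReal (φ t + ε n))⁻¹) atTop := by
      intro t
      have : Tendsto (fun n => (ENNReal.ofReal (φ t + ε n))⁻¹) atTop
          (𝓝 (ENNReal.ofReal (φ t + 0))⁻¹) :=
        (continuous_inv.tendsto _).comp
          ((ENNReal.continuous_ofReal.tendsto _).comp (hεt.const_add (φ t)))
      rw [add_zero] at this
      exact this.liminf_eq.symm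
    simp only [h1]
    refine (lintegral_liminf_le fun n => by fun_prop).trans ?_
    refine liminf_le_of_le (by isBoundedDefault) fun b hb => ?_
    obtain ⟨n, hn⟩ := hb.exists
    exact hn.trans (hbound n)
  -- In `ENNReal` the inverse of `0` is `∞`, so the Fatou bound also excludes zeros of `φ` almost
  -- everywhere.
  have hpos : ∀ᵐ t ∂σ, 0 < φ t := by
    have hm : Measurable fun t => (ENNReal.ofReal (φ t))⁻¹ := by fun_prop
    filter_upwards [ae_lt_top hm (hfatou.trans_lt ENNReal.ofReal_lt_top).ne] with t ht
    rw [ENNReal.inv_lt_top, ENNReal.ofReal_pos] at ht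
    exact ht
  refine ⟨hpos, by fun_prop, ?_⟩
  rw [hasFiniteIntegral_iff_enorm]
  refine lt_of_eq_of_lt (lintegral_congr_ae ?_) (hfatou.trans_lt ENNReal.ofReal_lt_top)
  filter_upwards [hpos] with t ht
  rw [← ofReal_norm, Real.norm_eq_abs, abs_of_pos (inv_pos.2 ht),
    ENNReal.ofReal_inv_of_pos ht]

theorem integral_inv_one_add_mul_ofReal (ρ : Measure ℝ) (w : ℝ) :
    ∫ t : ℝ, (1 + (w : ℂ) * (t : ℂ))⁻¹ ∂ρ = ((∫ t : ℝ, (1 + w * t)⁻¹ ∂ρ : ℝ) : ℂ) := by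
  rw [← integral_complex_ofReal]
  push_cast
  rfl

/-- The reciprocal of the transform of a nonzero measure on `[0, 1]`, divided by `1 + z`, is the
Laplace transform of a bounded measure. -/
theorem exists_laplaceTransform_reciprocal (ρ : Measure ℝ) [IsFiniteMeasure ρ] (hρ0 : ρ ≠ 0)
    (hρ : ∀ᵐ t ∂ρ, t ∈ Set.Icc (0 : ℝ) 1) :
    ∃ l : ℂ → ℂ, (IsLaplaceTransform fun z => (1 + z)⁻¹ * l z) ∧
      ∀ z : ℂ, 0 < z.re → (∫ t : ℝ, (1 + (z - 1) * (t : ℂ))⁻¹ ∂ρ) * l z = 1 := by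
  obtain ⟨c, σ, hσ, hσ1, h⟩ := exists_reciprocal_transform ρ hρ
  set m : ℝ := ρ.real Set.univ with hm
  have hm0 : 0 < m := by
    have : ρ Set.univ ≠ 0 := by simpa using hρ0
    exact ENNReal.toReal_pos this (measure_ne_top _ _)
  -- For real `w > -1` the transform of `ρ` is nonnegative and its product with the second factor is
  -- `m² > 0`, so that factor cannot be negative.
  have hpos : ∀ w : ℝ, -1 < w → w ^ 2 * ∫ t : ℝ, (1 + w * t)⁻¹ ∂σ ≤ m + w * c := by
    intro w hw
    have h1 := h w (by simp; linarith)
    rw [integral_inv_one_add_mul_ofReal, integral_inv_one_add_mul_ofReal] at h1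
    norm_cast at h1
    have h2 : 0 ≤ ∫ t : ℝ, (1 + w * t)⁻¹ ∂ρ := by
      refine integral_nonneg_of_ae ?_
      filter_upwards [hρ] with t ht
      have := re_one_add_mul_pos (w := (w : ℂ)) (by simp; linarith) ht
      norm_cast at this
      exact (inv_pos.2 this).le
    by_contra hlt
    push Not at hlt
    nlinarith [mul_nonneg h2 (by linarith : 0 ≤ -(m + w * c - w ^ 2 * ∫ t : ℝ, (1 + w * t)⁻¹ ∂σ)),
      pow_pos hm0 2]
  have hintσ : ∀ w : ℝ, -1 < w → Integrable (fun t : ℝ => (1 + w * t)⁻¹) σ := by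
    intro w hw
    have := (integrable_inv_one_add_mul hσ1 (w := (w : ℂ)) (by simp; linarith)).re
    refine this.congr (Eventually.of_forall fun t => ?_)
    have : ((1 + (w : ℂ) * (t : ℂ))⁻¹) = (((1 + w * t)⁻¹ : ℝ) : ℂ) := by push_cast; rfl
    simp only [this]
    rfl
  -- Behaviour as `w → ∞`: `w = 1/ε` in `hpos` gives `∫ (t + ε)⁻¹ dσ ≤ εm + c`.
  obtain ⟨hp0, hp⟩ := integrable_inv_of_integral_inv_add_le (σ := σ) (φ := fun t => t)
    (C := m + |c|) measurable_id (hσ1.mono fun t ht => ht.1) (fun ε hε hε1 => by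
      have h1 := hpos ε⁻¹ (by have := inv_pos.2 hε; linarith)
      have h2 : ∫ t : ℝ, (t + ε)⁻¹ ∂σ = ε⁻¹ * ∫ t : ℝ, (1 + ε⁻¹ * t)⁻¹ ∂σ := by
        rw [← integral_const_mul]
        refine integral_congr_ae (Eventually.of_forall fun t => ?_)
        simp only
        rw [← mul_inv]
        congr 1
        field_simp
        ring
      have h3 : ε⁻¹ * (ε⁻¹ * ∫ t : ℝ, (1 + ε⁻¹ * t)⁻¹ ∂σ) ≤ m + ε⁻¹ * c := by
        rw [← mul_assoc, ← sq]; exact h1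
      rw [← h2, inv_mul_le_iff₀ hε] at h3
      have h4 : ε * (m + ε⁻¹ * c) = ε * m + c := by field_simp
      rw [h4] at h3
      have : ε * m ≤ m := mul_le_of_le_one_left hm0.le (by linarith)
      linarith [le_abs_self c])
  -- Behaviour as `w → -1`: take `w = -1 + ε`, where `1 + wt ≤ 1 - t + ε`. The factor `4` comes from
  -- `w² ≥ 1/4` for `ε ≤ 1/2`.
  obtain ⟨hq0, hq⟩ := integrable_inv_of_integral_inv_add_le (σ := σ) (φ := fun t => 1 - t)
    (C := 4 * (m + |c|)) (by fun_prop) (hσ1.mono fun t ht => sub_nonneg.2 ht.2)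
    (fun ε hε hε1 => by
      have h1 := hpos (-1 + ε) (by linarith)
      have h2 : ∫ t : ℝ, (1 - t + ε)⁻¹ ∂σ ≤ ∫ t : ℝ, (1 + (-1 + ε) * t)⁻¹ ∂σ := by
        refine integral_mono_of_nonneg ?_ (hintσ _ (by linarith)) ?_
        · filter_upwards [hσ1] with t ht
          exact inv_nonneg.2 (by linarith [ht.2])
        · filter_upwards [hσ1] with t ht
          have := re_one_add_mul_pos (w := ((-1 + ε : ℝ) : ℂ)) (by simpa using hε) ht
          rw [← Complex.ofReal_mul, ← Complex.ofReal_one, ← Complex.ofReal_add,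
            Complex.ofReal_re] at this
          exact inv_anti₀ this (by nlinarith [ht.1, ht.2])
      have h3 : 0 ≤ ∫ t : ℝ, (1 + (-1 + ε) * t)⁻¹ ∂σ := le_trans (by
        refine integral_nonneg_of_ae ?_
        filter_upwards [hσ1] with t ht
        exact inv_nonneg.2 (by linarith [ht.2])) h2
      have h4 : 1 / 4 ≤ (-1 + ε) ^ 2 := by nlinarith
      have h5 : (-1 + ε) * c ≤ |c| := by
        refine (le_abs_self _).trans ?_
        rw [abs_mul]
        refine mul_le_of_le_one_left (abs_nonneg _) ?_
        rw [abs_le]; constructor <;> linarith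
      have h6 := mul_le_mul_of_nonneg_right h4 h3
      linarith)
  -- `k(t) = 1 / (t(1 - t))` and `r = t / (1 - t)` come from `1 + (z - 1)t = (1 - t)(1 + rz)`.
  set k : ℝ → ℝ := fun t => t⁻¹ + (1 - t)⁻¹ with hk
  have hkint : Integrable k σ := hp.add hq
  set σ' : Measure ℝ := σ.withDensity fun t => ENNReal.ofReal (k t) with hσ'
  have hσ'fin : IsFiniteMeasure σ' := isFiniteMeasure_withDensity_ofReal hkint.2
  set r : ℝ → ℝ≥0 := fun t => (t / (1 - t)).toNNReal with hr
  have hrm : Measurable r := by fun_prop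
  have hG := isLaplaceTransform_integral_inv σ' hrm
  have hE := isLaplaceTransform_inv_one_add
  set p : ℝ := ∫ t : ℝ, t⁻¹ ∂σ with hpdef
  refine ⟨fun z => ((m : ℂ) ^ 2)⁻¹ * ((m : ℂ) + (z - 1) * c -
    (z - 1) ^ 2 * ∫ t : ℝ, (1 + (z - 1) * (t : ℂ))⁻¹ ∂σ), ?_, fun z hz => ?_⟩
  -- With `w = z - 1`, `hkey` rewrites the bracket as `m + w(c - p + G)`, where `G` is the mixture
  -- of exponentials; division by `1 + z` leaves `w / (1 + z) = 1 - 2 / (1 + z)`.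
  · refine ((isLaplaceTransform_const ((m : ℂ) ^ 2)⁻¹).mul
      (((isLaplaceTransform_const (m : ℂ)).mul hE).add
        (((isLaplaceTransform_const 1).add ((isLaplaceTransform_const (-2)).mul hE)).mul
          ((isLaplaceTransform_const ((c - p : ℝ) : ℂ)).add hG)))).congr fun z hz => ?_
    have hw : 0 < (1 + (z - 1)).re := by simpa using hz
    -- Pointwise this is `t⁻¹ - w(1 + wt)⁻¹ = 1 / (t(1 + wt))` with `w = z - 1`.
    have hkey : ∫ θ, (1 + ((r θ : ℝ) : ℂ) * z)⁻¹ ∂σ' =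
        p - (z - 1) * ∫ t : ℝ, (1 + (z - 1) * (t : ℂ))⁻¹ ∂σ := by
      have e1 := integral_withDensity_eq_integral_toReal_smul₀ (μ := σ)
        (f := fun t => ENNReal.ofReal (k t)) (by fun_prop)
        (Eventually.of_forall fun ω => ENNReal.ofReal_lt_top)
        (fun θ => (1 + ((r θ : ℝ) : ℂ) * z)⁻¹)
      have hpc : Integrable (fun t : ℝ => ((t⁻¹ : ℝ) : ℂ)) σ := hp.ofReal
      rw [hσ', e1, hpdef, ← integral_complex_ofReal, ← integral_const_mul, ← integral_sub hpc
        ((integrable_inv_one_add_mul hσ1 hw).const_mul _)]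
      refine integral_congr_ae ?_
      filter_upwards [hσ1, hp0, hq0] with t ht ht0 ht1
      have hkt : 0 ≤ k t := add_nonneg (inv_pos.2 ht0).le (inv_pos.2 ht1).le
      have hrt : ((r t : ℝ≥0) : ℝ) = t / (1 - t) := Real.coe_toNNReal _ (div_nonneg ht0.le ht1.le)
      have hne : 1 + (z - 1) * (t : ℂ) ≠ 0 := fun h => by
        have := re_one_add_mul_pos hw ht
        rw [h, Complex.zero_re] at this
        exact this.false
      have hne1 : (t : ℂ) ≠ 0 := by exact_mod_cast ht0.ne'
      have hne2 : 1 - (t : ℂ) ≠ 0 := by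
        have := ht1.ne'
        exact_mod_cast this
      have e2 : 1 + ((t / (1 - t) : ℝ) : ℂ) * z = (1 + (z - 1) * (t : ℂ)) / (1 - t) := by
        push_cast
        field_simp
        ring
      rw [ENNReal.toReal_ofReal hkt, hrt, e2, Complex.real_smul, hk, inv_div, div_eq_mul_inv]
      have hI := mul_inv_cancel₀ hne
      push_cast
      generalize (1 + (z - 1) * (t : ℂ))⁻¹ = I at hI ⊢
      field_simp
      linear_combination hI
    have hz1 : 1 + z ≠ 0 := fun h => by
      have := congrArg Complex.re h
      simp at this
      linarith
    rw [hkey]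
    push_cast
    generalize ∫ t : ℝ, (1 + (z - 1) * (t : ℂ))⁻¹ ∂σ = I
    have hm' : (m : ℂ) ≠ 0 := by exact_mod_cast hm0.ne'
    field_simp
    ring
  · have := h (z - 1) (by simpa using hz)
    have hm' : (m : ℂ) ≠ 0 := by exact_mod_cast hm0.ne'
    rw [mul_left_comm, this, inv_mul_cancel₀ (pow_ne_zero 2 hm')]

end Reciprocal

/-! ### Stieltjes functions and the theorem -/

section Stieltjes

/-- The reciprocal of a nonzero Stieltjes function, divided by `1 + z`, is the Laplace transform
of a bounded measure. -/
theorem IsStieltjes.exists_laplaceTransform_reciprocal {f : ℂ → ℂ} (hf : IsStieltjes f)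
    (hf0 : ∃ z ∈ Complex.slitPlane, f z ≠ 0) :
    ∃ l : ℂ → ℂ, (IsLaplaceTransform fun z => (1 + z)⁻¹ * l z) ∧
      ∀ z : ℂ, 0 < z.re → f z * l z = 1 := by
  obtain ⟨a, μ, hμ, hfz⟩ := hf
  -- The substitution `t = 1 / (1 + τ)` maps `[0, ∞)` into `[0, 1]` and gives `1 / (z + τ) = t / (1
  -- + (z - 1)t)`; the weight `t` makes the measure finite.
  set j : ℝ≥0 → ℝ := fun τ => (1 + (τ : ℝ))⁻¹ with hj
  have hjm : Measurable j := by fun_prop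
  have hj0 : ∀ τ, 0 < j τ := fun τ => inv_pos.2 (by positivity)
  set ρ₁ : Measure ℝ := (μ.withDensity fun τ => ENNReal.ofReal (j τ)).map j with hρ₁
  have hfin : IsFiniteMeasure (μ.withDensity fun τ => ENNReal.ofReal (j τ)) :=
    isFiniteMeasure_withDensity_ofReal hμ.2
  have hint : ∀ z : ℂ, ∫ t : ℝ, (1 + (z - 1) * (t : ℂ))⁻¹ ∂ρ₁ =
      ∫ τ : ℝ≥0, (z + ((τ : ℝ) : ℂ))⁻¹ ∂μ := by
    intro z
    have hm : Measurable fun t : ℝ => (1 + (z - 1) * (t : ℂ))⁻¹ := by fun_prop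
    rw [hρ₁, integral_map hjm.aemeasurable hm.aestronglyMeasurable,
      integral_withDensity_eq_integral_toReal_smul₀ (μ := μ) (by fun_prop)
        (Eventually.of_forall fun ω => ENNReal.ofReal_lt_top)]
    refine integral_congr_ae (Eventually.of_forall fun τ => ?_)
    have h1 : (1 + ((τ : ℝ) : ℂ)) ≠ 0 := by
      have : (1 + (τ : ℝ)) ≠ 0 := by positivity
      exact_mod_cast this
    simp only
    rw [ENNReal.toReal_ofReal (hj0 τ).le, Complex.real_smul, hj]
    push_cast
    rw [← mul_inv]
    congr 1
    field_simp
    ring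
  -- The constant `a` becomes an atom at `t = 0`, where the kernel equals `1`.
  set ρ : Measure ℝ := a • Measure.dirac 0 + ρ₁ with hρ
  have hρ1 : ∀ᵐ t ∂ρ₁, t ∈ Set.Icc (0 : ℝ) 1 := by
    refine (ae_map_iff hjm.aemeasurable measurableSet_Icc).2 (Eventually.of_forall fun τ => ?_)
    exact ⟨(hj0 τ).le, inv_le_one_of_one_le₀ (by simp)⟩
  have hρ2 : ∀ᵐ t ∂(a • Measure.dirac (0 : ℝ)), t ∈ Set.Icc (0 : ℝ) 1 := by
    refine Measure.ae_smul_measure ?_ a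
    rw [ae_dirac_eq]
    exact ⟨le_rfl, zero_le_one⟩
  have hρm : ∀ᵐ t ∂ρ, t ∈ Set.Icc (0 : ℝ) 1 := by
    rw [hρ, ae_add_measure_iff]
    exact ⟨hρ2, hρ1⟩
  have hρ0 : ρ ≠ 0 := by
    intro h0
    have h1 : a • Measure.dirac (0 : ℝ) = 0 :=
      le_antisymm (h0 ▸ Measure.le_add_right le_rfl) (Measure.zero_le _)
    have h2 : ρ₁ = 0 := le_antisymm (h0 ▸ Measure.le_add_left le_rfl) (Measure.zero_le _)
    obtain ⟨z, hz, hne⟩ := hf0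
    refine hne ?_
    have ha : a = 0 := by
      have := congrArg (fun m : Measure ℝ => m Set.univ) h1
      simpa using this
    rw [hfz z hz, ← hint, h2, ha]
    simp
  obtain ⟨l, hl, hl1⟩ := _root_.exists_laplaceTransform_reciprocal ρ hρ0 hρm
  refine ⟨l, hl, fun z hz => ?_⟩
  rw [← hl1 z hz, hfz z (Or.inl hz)]
  congr 1
  have hw : 0 < (1 + (z - 1)).re := by simpa using hz
  rw [hρ, integral_add_measure (integrable_inv_one_add_mul hρ2 hw)
    (integrable_inv_one_add_mul hρ1 hw), hint, integral_smul_nnreal_measure]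
  simp [NNReal.smul_def]

end Stieltjes

theorem theorem5p2 {X : Type*} [NormedAddCommGroup X] [NormedSpace ℂ X] [CompleteSpace X]
    (A : X →ₗ.[ℂ] X) (T : BoundedC0Semigroup X) (hA : IsGenerator T (-A))
    (f : ℂ → ℂ) (hf : IsStieltjesProduct f) (hf0 : ∃ z ∈ Complex.slitPlane, f z ≠ 0)
    (g : ℂ → ℂ) (hg : ∀ z : ℂ, 0 < z.re → g z = 1 / f z) :
    ∃ (h₀ : IsRegularizable T g) (h : ∀ δ : ℝ≥0, IsRegularizable (T.shift δ) g),
      ∀ x ∈ domSq A,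
        ∃ (hx₀ : x ∈ (extHP T g h₀).domain)
          (hx : ∀ δ : ℝ≥0, x ∈ (extHP (T.shift δ) g (h δ)).domain),
          Tendsto (fun δ : ℝ≥0 => extHP (T.shift δ) g (h δ) ⟨x, hx δ⟩) (𝓝[>] 0)
            (𝓝 (extHP T g h₀ ⟨x, hx₀⟩)) := by
  obtain ⟨f₁, f₂, hf₁, hf₂, hmul⟩ := hf
  obtain ⟨z₀, hz₀, hne⟩ := hf0
  rw [hmul z₀ hz₀] at hne
  obtain ⟨l₁, hl₁, h₁⟩ :=
    hf₁.exists_laplaceTransform_reciprocal ⟨z₀, hz₀, left_ne_zero_of_mul hne⟩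
  obtain ⟨l₂, hl₂, h₂⟩ :=
    hf₂.exists_laplaceTransform_reciprocal ⟨z₀, hz₀, right_ne_zero_of_mul hne⟩
  refine tendsto_extHP_shift hA ((hl₁.mul hl₂).congr fun z hz => ?_)
  -- Each factor `(1 + z)⁻¹` of the regularizer absorbs one reciprocal.
  have hgz : g z = l₁ z * l₂ z := by
    rw [hg z hz, hmul z (Or.inl hz), eq_comm]
    refine eq_one_div_of_mul_eq_one_left ?_
    linear_combination (f₂ z * l₂ z) * h₁ z hz + h₂ z hz
  rw [hgz]
  ring
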